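/- **Proposition 2.1.** Let $T^2=\mathbb R^2/\mathbb Z^2$ with circle coordinates $\theta=(\theta^1,\theta^2)$, let $\sigma=\sigma_{ij}\,d\theta^i d\theta^j$ be a flat metric on $T^2$ with constant coefficients (a positive definite symmetric matrix), and let $M_k=(\mathbb R\times T^2,\ b=ds^2+e^{2s}\sigma)$ be the Kottler manifold. For a smooth function $u$ on $T^2$ let $\nu$ denote the unit normal of the graph $\{(u(\theta),\theta)\}\subset M_k$ pointing towards infinity ($s\to\infty$), that is, $\nu=\rho^{-1}(\partial_s-e^{-2u}\sigma^{ij}\partial_j u\,\partial_{\theta^i})$ with $\rho^2=1+e^{-2u}|\nabla u|_\sigma^2$, and let $h_{ij}=b(\pmb\nabla_i\nu,X_j)$ be its second fundamental form, where $\pmb\nabla$ is the Levi-Civita connection of $b$ and $X_j=\partial_{\theta^j}+\partial_j u\,\partial_s$ are the coordinate tangent vectors of the graph. A *unit normal flow* on a time interval $I=[0,\infty)$ or $I=[0,T)$, starting from the graph $\Sigma_0$ of a smooth function $v_0:T^2\to\mathbb R$, consists of functions $v(t,\cdot):T^2\to\mathbb R$, smooth in $(t,\theta)\in I\times T^2$,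 and diffeomorphisms $\Theta(t,\cdot):T^2\to T^2$, $t\in I$, with $v(0,\cdot)=v_0$ and $\Theta(0,\cdot)=\mathrm{Id}$, such that $$F(t,\bar\theta)=\bigl(v(t,\Theta(t,\bar\theta)),\Theta(t,\bar\theta)\bigr)$$ is smooth on $I\times T^2$ and satisfies $\partial_tF=\nu$, where $\nu$ is the above unit normal of the graph $\Sigma_t=F(t,T^2)$ of $v(t,\cdot)$ at the point $F(t,\bar\theta)$. Suppose that the second fundamental form of $\Sigma_0$ is positive semidefinite at every point. Then: 1. there is a unit normal flow $(v,\Theta)$ starting from $\Sigma_0$ on $[0,\infty)$ (so it exists for all time as smooth graphs), and it is *the* flow: for every $T>0$, every unit normal flow starting from $\Sigma_0$ on $[0,T)$ agrees with $(v,\Theta)$ on $[0,T)$; 2. there is a smooth function $f$ on $T^2$ such that, as $t\to\infty$, $v(t,\cdot)-t\to f$ in $C^\ell(T^2)$ for every integer $\ell\ge 0$; 3. there is a diffeomorphism $\Theta_\infty:T^2\to T^2$ such that, as $t\to\infty$, $\Theta(t,\cdot)\to\Theta_\infty$ smoothly, i.e. uniformly together with all derivatives in the circle coordinates. -/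

import Mathlib

open Set Filter Topology
open scoped ContDiff

noncomputable section

namespace KottlerFlow

/-! ### The torus and smooth maps on it -/

/-- The 2-torus `T² = ℝ²/ℤ²`, with circle coordinates `(θ¹, θ²)`. -/
abbrev Torus : Type := UnitAddTorus (Fin 2)

/-- The universal covering `ℝ² → T²`. -/
def torusProj (x : Fin 2 → ℝ) : Torus := fun i => (x i : UnitAddCircle)

/-- The function on `ℝ²` that expresses `f : T² → ℝ` in the (multivalued) circle coordinates. -/
def pullback (f : Torus → ℝ) : (Fin 2 → ℝ) → ℝ := fun x => f (torusProj x)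

/-- `f : T² → ℝ` is smooth. -/
def SmoothFun (f : Torus → ℝ) : Prop := ContDiff ℝ ∞ (pullback f)

/-- `A : ℝ² → ℝ²` is smooth and is a lift of `Φ : T² → T²` to the universal covers. -/
def IsSmoothLift (A : (Fin 2 → ℝ) → (Fin 2 → ℝ)) (Φ : Torus → Torus) : Prop :=
  ContDiff ℝ ∞ A ∧ ∀ x, torusProj (A x) = Φ (torusProj x)

/-- `Φ : T² → T²` is smooth (`ℝ²` being simply connected and `ℝ² → T²` a covering by local
diffeomorphisms, this holds exactly when `Φ` has a smooth lift). -/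
def SmoothTorusMap (Φ : Torus → Torus) : Prop := ∃ A, IsSmoothLift A Φ

/-- `Φ : T² → T²` is a (smooth) diffeomorphism. -/
def IsTorusDiffeo (Φ : Torus → Torus) : Prop :=
  SmoothTorusMap Φ ∧
    ∃ Ψ : Torus → Torus, SmoothTorusMap Ψ ∧ Function.LeftInverse Ψ Φ ∧ Function.RightInverse Ψ Φ

/-- `u(t, ·) → f` in `C^ℓ(T²)` as `t → ∞`: all derivatives of order at most `ℓ` in the circle
coordinates converge uniformly. -/
def ConvergesInC (ℓ : ℕ) (u : ℝ → Torus → ℝ) (f : Torus → ℝ) : Prop :=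
  ∀ m ≤ ℓ, TendstoUniformly (fun t => iteratedFDeriv ℝ m (pullback (u t)))
    (iteratedFDeriv ℝ m (pullback f)) atTop

/-- `Θ(t, ·) → Θ∞` smoothly, as maps `T² → T²`, as `t → ∞`: for suitable lifts to `ℝ²` the
derivatives of every order (including order zero) converge uniformly. -/
def ConvergesSmoothly (Θ : ℝ → Torus → Torus) (Θinf : Torus → Torus) : Prop :=
  ∃ (A : ℝ → (Fin 2 → ℝ) → (Fin 2 → ℝ)) (B : (Fin 2 → ℝ) → (Fin 2 → ℝ)),
    (∀ᶠ t in atTop, IsSmoothLift (A t) (Θ t)) ∧ IsSmoothLift B Θinf ∧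
      ∀ m : ℕ, TendstoUniformly (fun t => iteratedFDeriv ℝ m (A t)) (iteratedFDeriv ℝ m B) atTop

/-! ### Riemannian geometry in coordinates -/

/-- The `i`-th partial derivative of `f` at `p`. -/
def pd {n : ℕ} (i : Fin n) (f : (Fin n → ℝ) → ℝ) (p : Fin n → ℝ) : ℝ :=
  fderiv ℝ f p (Pi.single i 1)

/-- The Christoffel symbol `Γᵏᵢⱼ` at `p` of the Levi-Civita connection of the metric with
coefficients `g`. -/
def christoffel {n : ℕ} (g : (Fin n → ℝ) → Matrix (Fin n) (Fin n) ℝ) (p : Fin n → ℝ)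
    (k i j : Fin n) : ℝ :=
  (1 / 2) * ∑ l, (g p)⁻¹ k l *
    (pd i (fun q => g q j l) p + pd j (fun q => g q i l) p - pd l (fun q => g q i j) p)

/-- The inner product `g(V, W)` at a point where the metric has the coefficient matrix `G`. -/
def metricInner {n : ℕ} (G : Matrix (Fin n) (Fin n) ℝ) (V W : Fin n → ℝ) : ℝ :=
  ∑ a, ∑ c, G a c * V a * W c

/-- The tangent vector `∂X/∂xⁱ` of a parametrized submanifold `X`. -/
def tangentVec {m n : ℕ} (X : (Fin m → ℝ) → (Fin n → ℝ)) (i : Fin m) (x : Fin m → ℝ) :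
    Fin n → ℝ :=
  fun a => pd i (fun y => X y a) x

/-- The Levi-Civita covariant derivative, in the direction `∂X/∂xⁱ`, of a vector field `N`
along the parametrized submanifold `X`. -/
def covDerivAlong {m n : ℕ} (g : (Fin n → ℝ) → Matrix (Fin n) (Fin n) ℝ)
    (X N : (Fin m → ℝ) → (Fin n → ℝ)) (i : Fin m) (x : Fin m → ℝ) : Fin n → ℝ :=
  fun k => pd i (fun y => N y k) x +
    ∑ a, ∑ c, christoffel g (X x) k a c * tangentVec X i x a * N x c

/-- The second fundamental form `hᵢⱼ = g(∇ᵢ N, ∂ⱼX)` of the parametrized hypersurface `X` with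
respect to the unit normal field `N`. -/
def secondFundamentalForm {m n : ℕ} (g : (Fin n → ℝ) → Matrix (Fin n) (Fin n) ℝ)
    (X N : (Fin m → ℝ) → (Fin n → ℝ)) (x : Fin m → ℝ) : Matrix (Fin m) (Fin m) ℝ :=
  Matrix.of fun i j => metricInner (g (X x)) (covDerivAlong g X N i x) (tangentVec X j x)

/-! ### The Kottler manifold and graphs in it -/

/-- The Kottler manifold `M_k = ℝ × T²`. -/
abbrev Kottler : Type := ℝ × Torus

/-- The universal covering of `M_k`; the coordinates are `(s, θ¹, θ²)`. -/
def kottlerProj (p : Fin 3 → ℝ) : Kottler := (p 0, torusProj (Matrix.vecTail p))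

/-- The coefficients of `b = ds² + e^{2s} σᵢⱼ dθⁱ dθʲ` in the coordinates `(s, θ¹, θ²)`. They
depend on `s` only, so `b` descends to `M_k`. -/
def kottlerMetric (σ : Matrix (Fin 2) (Fin 2) ℝ) (p : Fin 3 → ℝ) : Matrix (Fin 3) (Fin 3) ℝ :=
  !![1, 0, 0;
    0, Real.exp (2 * p 0) * σ 0 0, Real.exp (2 * p 0) * σ 0 1;
    0, Real.exp (2 * p 0) * σ 1 0, Real.exp (2 * p 0) * σ 1 1]

/-- The graph over the `s`-level sets, in coordinates: `x ↦ (u(x), x)`. -/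
def graphParam (u : (Fin 2 → ℝ) → ℝ) (x : Fin 2 → ℝ) : Fin 3 → ℝ := Matrix.vecCons (u x) x

/-- `N` is the unit normal, pointing towards infinity (`s → ∞`), of the graph of `u` at the point
over `x`. -/
def IsUpwardUnitNormal (σ : Matrix (Fin 2) (Fin 2) ℝ) (u : (Fin 2 → ℝ) → ℝ) (x : Fin 2 → ℝ)
    (N : Fin 3 → ℝ) : Prop :=
  (∀ i, metricInner (kottlerMetric σ (graphParam u x)) N (tangentVec (graphParam u) i x) = 0) ∧
    metricInner (kottlerMetric σ (graphParam u x)) N N = 1 ∧ 0 < N 0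

/-- `vⁱ = σⁱʲ ∂ⱼu`. -/
def flatGrad (σ : Matrix (Fin 2) (Fin 2) ℝ) (u : (Fin 2 → ℝ) → ℝ) (x : Fin 2 → ℝ) : Fin 2 → ℝ :=
  fun i => ∑ j, σ⁻¹ i j * pd j u x

/-- `ρ = (1 + e^{-2u} |∇u|²_σ)^{1/2}`. -/
def rho (σ : Matrix (Fin 2) (Fin 2) ℝ) (u : (Fin 2 → ℝ) → ℝ) (x : Fin 2 → ℝ) : ℝ :=
  Real.sqrt (1 + Real.exp (-2 * u x) * ∑ i, flatGrad σ u x i * pd i u x)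

/-- The unit normal `ν = ρ⁻¹ (∂ₛ - e^{-2u} uⁱ ∂ᵢ)` of the graph of `u` pointing towards infinity;
see `isUpwardUnitNormal_iff`. -/
def graphNormal (σ : Matrix (Fin 2) (Fin 2) ℝ) (u : (Fin 2 → ℝ) → ℝ) (x : Fin 2 → ℝ) :
    Fin 3 → ℝ :=
  Matrix.vecCons ((rho σ u x)⁻¹)
    (fun i => -((rho σ u x)⁻¹ * Real.exp (-2 * u x) * flatGrad σ u x i))

theorem tangentVec_graphParam (u : (Fin 2 → ℝ) → ℝ) (i : Fin 2) (x : Fin 2 → ℝ) :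
    tangentVec (graphParam u) i x = Matrix.vecCons (pd i u x) (Pi.single i 1) := by
  funext a
  refine Fin.cases ?_ (fun j => ?_) a
  · simp [tangentVec, graphParam]
  · have h : HasFDerivAt (fun y : Fin 2 → ℝ => graphParam u y j.succ)
        (ContinuousLinearMap.proj (R := ℝ) (φ := fun _ : Fin 2 => ℝ) j) x := by
      simpa [graphParam] using hasFDerivAt_apply (𝕜 := ℝ) j x
    simp only [tangentVec, pd, h.fderiv]
    simp

theorem metricInner_kottlerMetric (σ : Matrix (Fin 2) (Fin 2) ℝ) (p V W : Fin 3 → ℝ) :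
    metricInner (kottlerMetric σ p) V W =
      V 0 * W 0 + Real.exp (2 * p 0) * ∑ i : Fin 2, ∑ j : Fin 2, σ i j * V i.succ * W j.succ := by
  simp [metricInner, kottlerMetric, Fin.sum_univ_three, Fin.sum_univ_two]
  ring

theorem sum_flatGrad {σ : Matrix (Fin 2) (Fin 2) ℝ} (hσ : σ.PosDef) (u : (Fin 2 → ℝ) → ℝ)
    (x : Fin 2 → ℝ) (i : Fin 2) : ∑ j, σ i j * flatGrad σ u x j = pd i u x := by
  have h : σ * σ⁻¹ = 1 := Matrix.mul_nonsing_inv _ hσ.det_pos.ne'.isUnit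
  have h2 : σ.mulVec (σ⁻¹.mulVec fun j => pd j u x) = fun j => pd j u x := by
    rw [Matrix.mulVec_mulVec, h, Matrix.one_mulVec]
  exact congrFun h2 i

theorem rho_sq {σ : Matrix (Fin 2) (Fin 2) ℝ} (hσ : σ.PosDef) (u : (Fin 2 → ℝ) → ℝ)
    (x : Fin 2 → ℝ) : 0 < rho σ u x ∧
      rho σ u x ^ 2 = 1 + Real.exp (-2 * u x) * ∑ i, flatGrad σ u x i * pd i u x := by
  have h : 0 ≤ ∑ i, flatGrad σ u x i * pd i u x := by
    have := hσ.posSemidef.dotProduct_mulVec_nonneg (flatGrad σ u x)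
    have e : σ.mulVec (flatGrad σ u x) = fun i => pd i u x :=
      funext fun i => sum_flatGrad hσ u x i
    rw [e] at this
    simpa [dotProduct] using this
  have h1 : 0 < 1 + Real.exp (-2 * u x) * ∑ i, flatGrad σ u x i * pd i u x := by positivity
  exact ⟨Real.sqrt_pos.2 h1, Real.sq_sqrt h1.le⟩

/-- `graphNormal` is the one and only upward unit normal. -/
theorem isUpwardUnitNormal_iff {σ : Matrix (Fin 2) (Fin 2) ℝ} (hσ : σ.PosDef)
    (u : (Fin 2 → ℝ) → ℝ) (x : Fin 2 → ℝ) (N : Fin 3 → ℝ) :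
    IsUpwardUnitNormal σ u x N ↔ N = graphNormal σ u x := by
  obtain ⟨hρ, hρ2⟩ := rho_sq hσ u x
  have hs : σ 1 0 = σ 0 1 := by simpa using hσ.isHermitian.apply 0 1
  have f0 := sum_flatGrad hσ u x 0
  have f1 := sum_flatGrad hσ u x 1
  have hd : σ 0 0 * σ 1 1 - σ 0 1 * σ 1 0 ≠ 0 := by
    rw [← Matrix.det_fin_two]; exact hσ.det_pos.ne'
  have hE : Real.exp (-2 * u x) * Real.exp (2 * u x) = 1 := by
    rw [← Real.exp_add]; simp
  have e1 : graphParam u x 0 = u x := rfl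
  simp only [Fin.sum_univ_two] at f0 f1 hρ2
  simp only [IsUpwardUnitNormal, tangentVec_graphParam, metricInner_kottlerMetric,
    Fin.forall_fin_two, Fin.sum_univ_two, e1, Matrix.cons_val_zero, Matrix.cons_val_succ,
    Pi.single_eq_same, Pi.single_eq_of_ne (zero_ne_one (α := Fin 2)),
    Pi.single_eq_of_ne (one_ne_zero (α := Fin 2)), mul_one, mul_zero, add_zero, zero_add]
  have hEp := Real.exp_pos (2 * u x)
  constructor
  · rintro ⟨⟨h0, h1⟩, h2, h3⟩
    set E := Real.exp (2 * u x)
    set E' := Real.exp (-2 * u x)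
    set w0 := flatGrad σ u x 0 with hw0
    set w1 := flatGrad σ u x 1 with hw1
    have k0 : σ 0 0 * (E * N 1 + N 0 * w0) + σ 0 1 * (E * N 2 + N 0 * w1) = 0 := by
      have : (Fin.succ 0 : Fin 3) = 1 ∧ (Fin.succ 1 : Fin 3) = 2 := ⟨rfl, rfl⟩
      rw [this.1, this.2] at h0
      linear_combination h0 + N 0 * f0 - E * N 2 * hs
    have k1 : σ 1 0 * (E * N 1 + N 0 * w0) + σ 1 1 * (E * N 2 + N 0 * w1) = 0 := by
      have : (Fin.succ 0 : Fin 3) = 1 ∧ (Fin.succ 1 : Fin 3) = 2 := ⟨rfl, rfl⟩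
      rw [this.1, this.2] at h1
      linear_combination h1 + N 0 * f1 + E * N 1 * hs
    have m0 : E * N 1 + N 0 * w0 = 0 := by
      refine (mul_eq_zero.1 ?_).resolve_left hd
      linear_combination σ 1 1 * k0 - σ 0 1 * k1
    have m1 : E * N 2 + N 0 * w1 = 0 := by
      refine (mul_eq_zero.1 ?_).resolve_left hd
      linear_combination σ 0 0 * k1 - σ 1 0 * k0
    have n0 : N 1 = -(N 0 * E' * w0) := by linear_combination E' * m0 - N 1 * hE
    have n1 : N 2 = -(N 0 * E' * w1) := by linear_combination E' * m1 - N 2 * hE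
    have q : (N 0 * rho σ u x) ^ 2 = 1 := by
      have e2 : (Fin.succ 0 : Fin 3) = 1 ∧ (Fin.succ 1 : Fin 3) = 2 := ⟨rfl, rfl⟩
      rw [e2.1, e2.2, n0, n1] at h2
      rw [mul_pow, hρ2, ← f0, ← f1]
      linear_combination h2 + (-(N 0 ^ 2 * E' * (w0 * (σ 0 0 * w0 + σ 0 1 * w1) +
        w1 * (σ 1 0 * w0 + σ 1 1 * w1)))) * hE
    have q1 : N 0 * rho σ u x = 1 := by
      have : 0 < N 0 * rho σ u x := mul_pos h3 hρ
      nlinarith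
    have n2 : N 0 = (rho σ u x)⁻¹ := eq_inv_of_mul_eq_one_left q1
    funext a
    fin_cases a
    · exact n2
    · show N 1 = _
      rw [n0, n2]; rfl
    · show N 2 = _
      rw [n1, n2]; rfl
  · rintro rfl
    simp only [graphNormal, Matrix.cons_val_zero, Matrix.cons_val_succ]
    have hr : (rho σ u x)⁻¹ * rho σ u x = 1 := inv_mul_cancel₀ hρ.ne'
    set r := (rho σ u x)⁻¹
    set E := Real.exp (2 * u x)
    set E' := Real.exp (-2 * u x)
    set w0 := flatGrad σ u x 0 with hw0
    set w1 := flatGrad σ u x 1 with hw1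
    refine ⟨⟨?_, ?_⟩, ?_, inv_pos.2 hρ⟩
    · rw [← f0]
      linear_combination (-(r * (σ 0 0 * w0 + σ 0 1 * w1))) * hE - E * E' * r * w1 * hs
    · rw [← f1]
      linear_combination (-(r * (σ 1 0 * w0 + σ 1 1 * w1))) * hE + E * E' * r * w0 * hs
    · rw [← f0, ← f1] at hρ2
      have hr2 : r ^ 2 * rho σ u x ^ 2 = 1 := by rw [← mul_pow, hr, one_pow]
      rw [hρ2] at hr2
      linear_combination hr2 + r ^ 2 * E' * (w0 * (σ 0 0 * w0 + σ 0 1 * w1) +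
        w1 * (σ 1 0 * w0 + σ 1 1 * w1)) * hE

/-- The second fundamental form of the graph of `u` in the Kottler manifold with respect to the
unit normal pointing towards infinity. -/
def graphSecondFF (σ : Matrix (Fin 2) (Fin 2) ℝ) (u : (Fin 2 → ℝ) → ℝ) (x : Fin 2 → ℝ) :
    Matrix (Fin 2) (Fin 2) ℝ :=
  secondFundamentalForm (kottlerMetric σ) (graphParam u) (graphNormal σ u) x

/-! ### The unit normal flow -/

/-- The map `F(t, θ) = (v(t, Θ(t, θ)), Θ(t, θ))` into `M_k`. -/
def flowMap (v : ℝ → Torus → ℝ) (Θ : ℝ → Torus → Torus) (t : ℝ) (θ : Torus) : Kottler :=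
  (v t (Θ t θ), Θ t θ)

/-- On the time interval `I` (which starts at `0`), `v` and `Θ` are the graph functions and the
reparametrizing diffeomorphisms of a smooth family of graphical embeddings
`F(t, ·) = (v(t, Θ(t, ·)), Θ(t, ·))` that solves the unit normal flow `∂ₜF = ν` and starts from
the graph of `v₀` with its standard parametrization. -/
structure IsUnitNormalFlow (σ : Matrix (Fin 2) (Fin 2) ℝ) (v₀ : Torus → ℝ) (I : Set ℝ)
    (v : ℝ → Torus → ℝ) (Θ : ℝ → Torus → Torus) : Prop where
  smooth_graph :
    ContDiffOn ℝ ∞ (fun p : ℝ × (Fin 2 → ℝ) => pullback (v p.1) p.2) (I ×ˢ univ)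
  diffeo : ∀ t ∈ I, IsTorusDiffeo (Θ t)
  init_graph : v 0 = v₀
  init_diffeo : Θ 0 = id
  /-- `G` is a lift of `F` to the universal covers, i.e. `F` written in the coordinates
  `(s, θ¹, θ²)`; it is smooth, and its velocity is the unit normal of the evolving graph. -/
  flow : ∃ G : ℝ → (Fin 2 → ℝ) → (Fin 3 → ℝ),
    ContDiffOn ℝ ∞ (fun p : ℝ × (Fin 2 → ℝ) => G p.1 p.2) (I ×ˢ univ) ∧
    (∀ t ∈ I, ∀ x, kottlerProj (G t x) = flowMap v Θ t (torusProj x)) ∧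
    ∀ t ∈ I, ∀ x, HasDerivWithinAt (fun τ => G τ x)
      (graphNormal σ (pullback (v t)) (Matrix.vecTail (G t x))) I t

end KottlerFlow

end

/-! A unit normal flow moves each point along the normal geodesic of the initial graph, and these
geodesics are explicit. Let `P` be the half-gradient of `e^{-2u}`, so that the normal is `ρ⁻¹ (∂ₛ +
P)`, and let `τ = tanh t`. The geodesic starting over `x` has foot point `x + τ / (ρ + τ) P`
(`footMap`) and height `u + log (cosh t + sinh t / ρ)` (`heightAlong`). The flow exists as a graph
for as long as the foot map is a diffeomorphism.

Convexity enters once. The second fundamental form equals `ρ⁻¹ e^{2u} σ((1 + DP)·, ·)`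
(`graphSecondFF_eq`), so it is nonnegative exactly when `1 + DP` is. This forces the derivative of
the foot map to be injective for every `τ ≥ 0` (`eq_zero_of_convex`). The foot map commutes with
integer translations, so it is a proper local homeomorphism of the simply connected plane, hence a
covering and a bijection (`bijective_of_fderiv_ker`). The Gauss lemma (`velocity_eq_graphNormal`)
then shows that the evolving graphs solve the flow.

The variable `τ` compactifies time. The value `τ = 1` stands for `t = ∞`, and the foot map, its
inverse and the renormalized height are smooth in `(τ, x)` near `τ = 1`. Smooth convergence is
therefore continuity at `τ = 1`, made uniform by periodicity (`tendstoUniformly_iteratedFDeriv`),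
and the limit map is a diffeomorphism because `footMap` at `τ = 1` is one.

Uniqueness is the method of characteristics. The graph functions of any flow solve `∂ₜv = ρ`
(`hasDerivAt_graph`), the flow curves are characteristics of this equation, and conserved quantities
along them recover the explicit geodesics (`characteristic_eq`). -/

noncomputable section

namespace KottlerFlow

/-! ### Periodic functions on the plane -/

/-- The integer vector `k`, as a vector of the plane. -/
def intVec (k : Fin 2 → ℤ) : Fin 2 → ℝ := fun i => (k i : ℝ)

theorem torusProj_eq_iff {x y : Fin 2 → ℝ} :
    torusProj x = torusProj y ↔ ∃ k, y = x + intVec k := by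
  constructor
  · intro h
    have h' : ∀ i, ∃ n : ℤ, y i = x i + n := fun i => by
      have := congrFun h i
      obtain ⟨n, hn⟩ := (QuotientAddGroup.eq (s := AddSubgroup.zmultiples (1 : ℝ))).1 this
      exact ⟨n, by simp at hn; linarith⟩
    choose k hk using h'
    exact ⟨k, funext hk⟩
  · rintro ⟨k, rfl⟩
    funext i
    refine (QuotientAddGroup.eq (s := AddSubgroup.zmultiples (1 : ℝ))).2 ⟨k i, ?_⟩
    simp [intVec]

theorem torusProj_add_intVec (x : Fin 2 → ℝ) (k : Fin 2 → ℤ) :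
    torusProj (x + intVec k) = torusProj x :=
  (torusProj_eq_iff.2 ⟨k, rfl⟩).symm

theorem torusProj_surjective : Function.Surjective torusProj := fun θ => by
  choose x hx using fun i => QuotientAddGroup.mk_surjective (s := AddSubgroup.zmultiples (1 : ℝ)) (θ i)
  exact ⟨x, funext hx⟩

/-- A function on the plane that is invariant under integer translations. -/
def IsPeriodic {α : Type*} (f : (Fin 2 → ℝ) → α) : Prop :=
  ∀ x k, f (x + intVec k) = f x

theorem isPeriodic_pullback (f : Torus → ℝ) : IsPeriodic (pullback f) := fun x k => by
  simp only [pullback, torusProj_add_intVec]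

/-- The function on the torus defined by a periodic function on the plane. -/
def descend {α : Type*} (f : (Fin 2 → ℝ) → α) (θ : Torus) : α :=
  f (Function.surjInv torusProj_surjective θ)

theorem descend_torusProj {α : Type*} {f : (Fin 2 → ℝ) → α} (hf : IsPeriodic f) (x : Fin 2 → ℝ) :
    descend f (torusProj x) = f x := by
  obtain ⟨k, hk⟩ := torusProj_eq_iff.1
    (Function.surjInv_eq torusProj_surjective (torusProj x)).symm
  rw [descend, hk, hf]

theorem exists_add_intVec_mem_Icc (x : Fin 2 → ℝ) :
    ∃ k, x + intVec k ∈ Icc (0 : Fin 2 → ℝ) 1 := by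
  refine ⟨fun i => -⌊x i⌋, fun i => ?_, fun i => ?_⟩
  · simpa [intVec] using Int.floor_le (x i)
  · have := (Int.lt_floor_add_one (x i)).le
    simp [intVec]; linarith

theorem IsPeriodic.exists_norm_le {f : (Fin 2 → ℝ) → Fin 2 → ℝ} (hf : IsPeriodic f)
    (hc : Continuous f) : ∃ C, ∀ x, ‖f x‖ ≤ C := by
  obtain ⟨C, hC⟩ := (isCompact_Icc (a := (0 : Fin 2 → ℝ)) (b := 1)).exists_bound_of_continuousOn
    hc.continuousOn
  refine ⟨C, fun x => ?_⟩
  obtain ⟨k, hk⟩ := exists_add_intVec_mem_Icc x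
  rw [← hf x k]
  exact hC _ hk

/-! ### Local diffeomorphisms of the plane that commute with integer translations -/

/-- The identity of the simply connected base lifts to a section `g` through any prescribed point.
Then `g ∘ f` and `id` are lifts of `f` that agree at one point of a connected space, hence
everywhere. -/
theorem bijective_of_isCoveringMap {X Y : Type*} [TopologicalSpace X] [TopologicalSpace Y]
    [PathConnectedSpace X] [SimplyConnectedSpace Y] [LocallyPathConnectedSpace Y] {f : X → Y}
    (hf : IsCoveringMap f) : Function.Bijective f := by
  obtain ⟨x₀⟩ : Nonempty X := inferInstance
  have key : ∀ x, ∃ g : C(Y, X), g (f x) = x ∧ f ∘ g = id := fun x => by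
    obtain ⟨g, hg, -⟩ := hf.existsUnique_continuousMap_lifts (ContinuousMap.id Y) (f x) x rfl
    exact ⟨g, hg⟩
  obtain ⟨g, hg, hfg⟩ := key x₀
  have hgf : g ∘ f = id := hf.eq_of_comp_eq (g.continuous.comp hf.continuous) continuous_id
    (by rw [← Function.comp_assoc, hfg]; rfl) x₀ hg
  exact ⟨Function.LeftInverse.injective (congrFun hgf),
    Function.RightInverse.surjective (congrFun hfg)⟩

theorem exists_equiv_of_ker {V : Type*} [NormedAddCommGroup V] [NormedSpace ℝ V]
    [FiniteDimensional ℝ V] (L : V →L[ℝ] V) (hL : ∀ v, L v = 0 → v = 0) :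
    ∃ e : V ≃L[ℝ] V, (e : V →L[ℝ] V) = L := by
  have hi : Function.Injective L.toLinearMap := (injective_iff_map_eq_zero _).2 hL
  refine ⟨(LinearEquiv.ofInjectiveEndo L.toLinearMap hi).toContinuousLinearEquiv, ?_⟩
  ext v
  rfl

/-- The inverse function theorem makes `f` a local homeomorphism, and the bounded displacement `f x
- x` makes it proper. Its fibres are compact and discrete, hence finite, so it is a covering of the
plane. -/
theorem bijective_of_fderiv_ker {f : (Fin 2 → ℝ) → Fin 2 → ℝ} (hf : ContDiff ℝ ∞ f)
    (hp : IsPeriodic fun x => f x - x) (hk : ∀ x v, fderiv ℝ f x v = 0 → v = 0) :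
    Function.Bijective f := by
  have hloc : IsLocalHomeomorph f := IsLocalHomeomorph.mk f fun x => by
    obtain ⟨e, he⟩ := exists_equiv_of_ker _ (hk x)
    have hd : HasFDerivAt f (e : (Fin 2 → ℝ) →L[ℝ] Fin 2 → ℝ) x := by
      rw [he]; exact (hf.differentiable (by simp) x).hasFDerivAt
    exact ⟨hf.contDiffAt.toOpenPartialHomeomorph f hd (by simp),
      hf.contDiffAt.mem_toOpenPartialHomeomorph_source hd (by simp), fun _ _ => rfl⟩
  obtain ⟨C, hC⟩ := hp.exists_norm_le (hf.continuous.sub continuous_id)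
  have hprop : IsProperMap f := by
    rw [isProperMap_iff_tendsto_cocompact]
    refine ⟨hf.continuous, ?_⟩
    rw [← Metric.cobounded_eq_cocompact, ← tendsto_norm_atTop_iff_cobounded]
    refine tendsto_atTop_mono (f := fun x => ‖x‖ - C) (fun x => ?_)
      (tendsto_atTop_add_const_right _ _ tendsto_norm_cobounded_atTop)
    have := norm_sub_norm_le x (f x)
    rw [norm_sub_rev] at this
    linarith [hC x]
  have hcov : IsCoveringMap f := by
    rw [isCoveringMap_iff_isCoveringMapOn_univ]
    refine hprop.isClosedMap.isCoveringMapOn_of_isLocalHomeomorphOn (fun y _ => ?_)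
      (fun x _ => hloc x)
    exact (hprop.isCompact_preimage isCompact_singleton).finite
      (IsDiscrete.of_openPartialHomeomorph f subset_rfl fun x _ => by
        obtain ⟨φ, hφ, h⟩ := hloc x
        exact ⟨φ, hφ, h.symm⟩)
  exact bijective_of_isCoveringMap hcov

/-- A smooth family of maps with invertible derivatives has a smooth family of inverses. -/
theorem contDiffWithinAt_inverse_family {V : Type*} [NormedAddCommGroup V] [NormedSpace ℝ V]
    [FiniteDimensional ℝ V] {A B : ℝ → V → V} {S : Set ℝ}
    (hBA : ∀ τ ∈ S, ∀ x, B τ (A τ x) = x) {τ₀ : ℝ} (hτ₀ : τ₀ ∈ S) {x₀ : V}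
    (hA : ContDiffAt ℝ ∞ (fun p : ℝ × V => A p.1 p.2) (τ₀, x₀))
    (hk : ∀ v, fderiv ℝ (A τ₀) x₀ v = 0 → v = 0) :
    ContDiffWithinAt ℝ ∞ (fun p : ℝ × V => B p.1 p.2) (S ×ˢ univ) (τ₀, A τ₀ x₀) := by
  -- The inverse function theorem is applied with the parameter carried along. The derivative of `Φ`
  -- is block triangular, so its kernel reduces to that of the derivative of `A τ₀`.
  set Φ : ℝ × V → ℝ × V := fun p => (p.1, A p.1 p.2) with hΦ
  have hΦs : ContDiffAt ℝ ∞ Φ (τ₀, x₀) := contDiffAt_fst.prodMk hA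
  set L := fderiv ℝ (fun p : ℝ × V => A p.1 p.2) (τ₀, x₀) with hL
  have hAd : HasFDerivAt (fun p : ℝ × V => A p.1 p.2) L (τ₀, x₀) :=
    (hA.differentiableAt (by simp)).hasFDerivAt
  have hΦd : HasFDerivAt Φ ((ContinuousLinearMap.fst ℝ ℝ V).prod L) (τ₀, x₀) :=
    hasFDerivAt_fst.prodMk hAd
  have hLr : ∀ v, L (0, v) = fderiv ℝ (A τ₀) x₀ v := fun v => by
    have h1 : HasFDerivAt (fun x => (τ₀, x)) (ContinuousLinearMap.inr ℝ ℝ V) x₀ :=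
      hasFDerivAt_prodMk_right τ₀ x₀
    have h2 : HasFDerivAt (A τ₀) (L.comp (ContinuousLinearMap.inr ℝ ℝ V)) x₀ :=
      HasFDerivAt.comp (f := fun x => (τ₀, x)) x₀ hAd h1
    rw [h2.fderiv]; simp
  obtain ⟨e, he⟩ := exists_equiv_of_ker ((ContinuousLinearMap.fst ℝ ℝ V).prod L) (by
    rintro ⟨a, v⟩ h
    obtain ⟨h1, h2⟩ := Prod.ext_iff.1 h
    simp only [ContinuousLinearMap.prod_apply, ContinuousLinearMap.coe_fst', Prod.fst_zero,
      Prod.snd_zero] at h1 h2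
    subst h1
    rw [hLr] at h2
    rw [hk v h2]; rfl)
  rw [← he] at hΦd
  have hinv := hΦs.to_localInverse hΦd (by simp)
  have hev : ∀ᶠ p in 𝓝 (Φ (τ₀, x₀)), Φ (hΦs.localInverse hΦd (by simp) p) = p :=
    (hΦs.hasStrictFDerivAt' hΦd (by simp)).eventually_right_inverse
  -- The local inverse of `Φ` preserves the parameter, and `B τ` is a left inverse of `A τ` only for
  -- `τ ∈ S`. Hence the two inverses agree only within `S`, of which `τ₀` may be a boundary point.
  have hB : ∀ p ∈ S ×ˢ (univ : Set V), Φ (hΦs.localInverse hΦd (by simp) p) = p →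
      B p.1 p.2 = (hΦs.localInverse hΦd (by simp) p).2 := by
    rintro ⟨τ, y⟩ ⟨hτ, -⟩ h
    obtain ⟨h1, h2⟩ := Prod.ext_iff.1 h
    simp only [hΦ] at h1 h2
    rw [h1] at h2
    rw [← hBA τ hτ (hΦs.localInverse hΦd (by simp) (τ, y)).2, h2]
  refine (contDiffAt_snd.comp (τ₀, A τ₀ x₀) hinv).contDiffWithinAt.congr_of_eventuallyEq ?_ ?_
  · filter_upwards [self_mem_nhdsWithin, nhdsWithin_le_nhds hev] with p hp hp'
    exact hB p hp hp'
  · exact hB _ ⟨hτ₀, mem_univ _⟩ hev.self_of_nhds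

/-! ### Uniform convergence of smooth families -/

theorem contDiffAt_iteratedFDeriv_family {V F : Type*} [NormedAddCommGroup V] [NormedSpace ℝ V]
    [NormedAddCommGroup F] [NormedSpace ℝ F] {W : ℝ → V → F} {τ : ℝ} {x : V}
    (hW : ContDiffAt ℝ ∞ (fun p : ℝ × V => W p.1 p.2) (τ, x)) (m : ℕ) :
    ContDiffAt ℝ ∞ (fun p : ℝ × V => iteratedFDeriv ℝ m (W p.1) p.2) (τ, x) := by
  induction m with
  | zero =>
    exact hW.continuousLinearMap_comp
      (continuousMultilinearCurryFin0 ℝ V F).symm.toContinuousLinearEquiv.toContinuousLinearMap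
  | succ m ih =>
    have h : ContDiffAt ℝ ∞ (fun p : ℝ × V => fderiv ℝ (iteratedFDeriv ℝ m (W p.1)) p.2) (τ, x) :=
      ContDiffAt.fderiv (f := fun (p : ℝ × V) y => iteratedFDeriv ℝ m (W p.1) y)
        (g := fun p => p.2) (x₀ := (τ, x)) (n := ∞)
        (ih.comp ((τ, x), x) ((contDiff_fst.fst.prodMk contDiff_snd).contDiffAt
          (f := fun q : (ℝ × V) × V => (q.1.1, q.2)))) contDiffAt_snd (by simp)
    exact h.continuousLinearMap_comp
      ((continuousMultilinearCurryLeftEquiv ℝ (fun _ : Fin (m + 1) => V) F).symm :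
        _ →L[ℝ] ContinuousMultilinearMap ℝ (fun _ : Fin (m + 1) => V) F)

/-- The constant `c` cancels in the difference at order zero and is killed by any derivative. It
allows one statement for periodic functions (`c = 0`) and for lifts of torus maps (`c = intVec k`).
-/
theorem dist_iteratedFDeriv_add_intVec {F : Type*} [NormedAddCommGroup F] [NormedSpace ℝ F]
    {f g : (Fin 2 → ℝ) → F} {k : Fin 2 → ℤ} {c : F} (hf : ∀ x, f (x + intVec k) = f x + c)
    (hg : ∀ x, g (x + intVec k) = g x + c) (m : ℕ) (x : Fin 2 → ℝ) :
    dist (iteratedFDeriv ℝ m f (x + intVec k)) (iteratedFDeriv ℝ m g (x + intVec k)) =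
      dist (iteratedFDeriv ℝ m f x) (iteratedFDeriv ℝ m g x) := by
  rw [← iteratedFDeriv_comp_add_right, ← iteratedFDeriv_comp_add_right]
  simp only [hf, hg]
  cases m with
  | zero =>
    rw [dist_eq_norm, dist_eq_norm]
    congr 1
    ext v
    simp
  | succ m =>
    simp only [iteratedFDeriv_succ_eq_comp_right, Function.comp_apply, fderiv_add_const]

/-- Joint continuity of the derivatives gives uniform convergence on the compact unit square, and
equivariance carries it to the whole plane. -/
theorem tendstoUniformly_iteratedFDeriv {F : Type*} [NormedAddCommGroup F] [NormedSpace ℝ F]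
    {W : ℝ → (Fin 2 → ℝ) → F} {τ₀ : ℝ}
    (hW : ∀ x, ContDiffAt ℝ ∞ (fun p : ℝ × (Fin 2 → ℝ) => W p.1 p.2) (τ₀, x))
    {c : (Fin 2 → ℤ) → F} (hp : ∀ᶠ τ in 𝓝 τ₀, ∀ k x, W τ (x + intVec k) = W τ x + c k) (m : ℕ) :
    TendstoUniformly (fun τ => iteratedFDeriv ℝ m (W τ)) (iteratedFDeriv ℝ m (W τ₀)) (𝓝 τ₀) := by
  have hK : TendstoUniformlyOn (fun τ => iteratedFDeriv ℝ m (W τ)) (iteratedFDeriv ℝ m (W τ₀))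
      (𝓝 τ₀) (Icc 0 1) := by
    rw [← tendstoLocallyUniformlyOn_iff_tendstoUniformlyOn_of_compact isCompact_Icc,
      Metric.tendstoLocallyUniformlyOn_iff]
    intro ε hε x _
    have h1 : ContinuousAt (fun p : ℝ × (Fin 2 → ℝ) => iteratedFDeriv ℝ m (W p.1) p.2) (τ₀, x) :=
      (contDiffAt_iteratedFDeriv_family (hW x) m).continuousAt
    have h2 : ContinuousAt (fun p : ℝ × (Fin 2 → ℝ) => iteratedFDeriv ℝ m (W τ₀) p.2) (τ₀, x) :=
      h1.comp (f := fun p : ℝ × (Fin 2 → ℝ) => (τ₀, p.2)) (x := (τ₀, x)) (by fun_prop)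
    have h3 : ∀ᶠ p in 𝓝 τ₀ ×ˢ 𝓝 x,
        dist (iteratedFDeriv ℝ m (W τ₀) p.2) (iteratedFDeriv ℝ m (W p.1) p.2) < ε := by
      rw [← nhds_prod_eq]
      exact (h2.dist h1).eventually (gt_mem_nhds (by simpa using hε))
    obtain ⟨pa, ha, pb, hb, hab⟩ := eventually_prod_iff.1 h3
    exact ⟨{y | pb y}, nhdsWithin_le_nhds hb, ha.mono fun τ hτ y hy => hab hτ hy⟩
  rw [Metric.tendstoUniformlyOn_iff] at hK
  rw [Metric.tendstoUniformly_iff]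
  intro ε hε
  filter_upwards [hK ε hε, hp] with τ hτ hpτ x
  obtain ⟨k, hk⟩ := exists_add_intVec_mem_Icc x
  rw [← dist_iteratedFDeriv_add_intVec (hp.self_of_nhds k) (hpτ k)]
  exact hτ _ hk

/-- Used for conservation laws along characteristics. At `t = 0` only continuity is asked for, since
the evolution equations are derived in the open interval. -/
theorem eq_of_hasDerivAt_zero {f : ℝ → ℝ} {T : ℝ} (hc : ContinuousOn f (Ico 0 T))
    (hd : ∀ t ∈ Ioo 0 T, HasDerivAt f 0 t) {t : ℝ} (ht : t ∈ Ico 0 T) : f t = f 0 := by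
  have h0 : (0 : ℝ) ∈ Ico 0 T := ⟨le_rfl, ht.1.trans_lt ht.2⟩
  have hi : interior (Ico (0 : ℝ) T) = Ioo 0 T := interior_Ico
  have hD : DifferentiableOn ℝ f (interior (Ico 0 T)) := fun s hs =>
    (hd s (hi ▸ hs)).differentiableAt.differentiableWithinAt
  refine le_antisymm ?_ ?_
  · exact antitoneOn_of_deriv_nonpos (convex_Ico 0 T) hc hD
      (fun s hs => (hd s (hi ▸ hs)).deriv.le) h0 ht ht.1
  · exact monotoneOn_of_deriv_nonneg (convex_Ico 0 T) hc hD
      (fun s hs => (hd s (hi ▸ hs)).deriv.ge) h0 ht ht.1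

/-! ### The half-gradient of `e^{-2u}` and the second fundamental form of a graph -/

theorem metricInner_two (σ : Matrix (Fin 2) (Fin 2) ℝ) (V W : Fin 2 → ℝ) :
    metricInner σ V W = σ 0 0 * V 0 * W 0 + σ 0 1 * V 0 * W 1 +
      (σ 1 0 * V 1 * W 0 + σ 1 1 * V 1 * W 1) := by
  simp [metricInner, Fin.sum_univ_two]

theorem metricInner_pos {σ : Matrix (Fin 2) (Fin 2) ℝ} (hσ : σ.PosDef) {V : Fin 2 → ℝ}
    (hV : V ≠ 0) : 0 < metricInner σ V V := by
  have := hσ.dotProduct_mulVec_pos hV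
  simp only [dotProduct, Matrix.mulVec, Fin.sum_univ_two, Pi.star_apply, star_trivial] at this
  rw [metricInner_two]
  linarith

theorem symm_of_posDef {σ : Matrix (Fin 2) (Fin 2) ℝ} (hσ : σ.PosDef) : σ 1 0 = σ 0 1 := by
  simpa using hσ.isHermitian.apply 0 1

/-- Half the gradient of `e^{-2u}` with respect to `σ`. -/
def halfGrad (σ : Matrix (Fin 2) (Fin 2) ℝ) (u : (Fin 2 → ℝ) → ℝ) (x : Fin 2 → ℝ) : Fin 2 → ℝ :=
  fun i => -(Real.exp (-2 * u x) * flatGrad σ u x i)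

theorem graphNormal_eq (σ : Matrix (Fin 2) (Fin 2) ℝ) (u : (Fin 2 → ℝ) → ℝ) (x : Fin 2 → ℝ) :
    graphNormal σ u x = Matrix.vecCons (rho σ u x)⁻¹ ((rho σ u x)⁻¹ • halfGrad σ u x) := by
  simp only [graphNormal]
  congr 1
  funext i
  simp [halfGrad, mul_assoc]

theorem fderiv_eq_pd (u : (Fin 2 → ℝ) → ℝ) (x ξ : Fin 2 → ℝ) :
    fderiv ℝ u x ξ = ξ 0 * pd 0 u x + ξ 1 * pd 1 u x := by
  have h : ξ = ξ 0 • Pi.single 0 1 + ξ 1 • Pi.single 1 1 := by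
    funext i; fin_cases i <;> simp
  conv_lhs => rw [h]
  simp [pd]

theorem metricInner_halfGrad {σ : Matrix (Fin 2) (Fin 2) ℝ} (hσ : σ.PosDef) (u : (Fin 2 → ℝ) → ℝ)
    (x ξ : Fin 2 → ℝ) :
    metricInner σ (halfGrad σ u x) ξ = -(Real.exp (-2 * u x) * fderiv ℝ u x ξ) := by
  have f0 := sum_flatGrad hσ u x 0
  have f1 := sum_flatGrad hσ u x 1
  have hs := symm_of_posDef hσ
  simp only [Fin.sum_univ_two] at f0 f1
  rw [metricInner_two, fderiv_eq_pd, ← f0, ← f1, hs]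
  simp only [halfGrad]
  ring

theorem metricInner_halfGrad_self {σ : Matrix (Fin 2) (Fin 2) ℝ} (hσ : σ.PosDef) (u : (Fin 2 → ℝ) → ℝ)
    (x : Fin 2 → ℝ) :
    metricInner σ (halfGrad σ u x) (halfGrad σ u x) =
      Real.exp (-2 * u x) * (rho σ u x ^ 2 - 1) := by
  rw [metricInner_halfGrad hσ, (rho_sq hσ u x).2, fderiv_eq_pd, Fin.sum_univ_two]
  simp only [halfGrad]
  ring

theorem one_le_rho {σ : Matrix (Fin 2) (Fin 2) ℝ} (hσ : σ.PosDef) (u : (Fin 2 → ℝ) → ℝ)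
    (x : Fin 2 → ℝ) : 1 ≤ rho σ u x := by
  obtain ⟨h1, h2⟩ := rho_sq hσ u x
  have h3 := metricInner_halfGrad_self hσ u x
  have h4 : 0 ≤ metricInner σ (halfGrad σ u x) (halfGrad σ u x) := by
    by_cases h : halfGrad σ u x = 0
    · rw [h]; simp [metricInner]
    · exact (metricInner_pos hσ h).le
  rw [h3] at h4
  have := nonneg_of_mul_nonneg_right h4 (Real.exp_pos _)
  nlinarith

theorem contDiff_pd {u : (Fin 2 → ℝ) → ℝ} (hu : ContDiff ℝ ∞ u) (i : Fin 2) : ContDiff ℝ ∞ (pd i u) :=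
  (hu.fderiv_right (by simp)).clm_apply contDiff_const

theorem contDiff_flatGrad {σ : Matrix (Fin 2) (Fin 2) ℝ} {u : (Fin 2 → ℝ) → ℝ} (hu : ContDiff ℝ ∞ u) :
    ContDiff ℝ ∞ (flatGrad σ u) :=
  contDiff_pi.2 fun _ => ContDiff.sum fun j _ => contDiff_const.mul (contDiff_pd hu j)

theorem contDiff_exp_neg {u : (Fin 2 → ℝ) → ℝ} (hu : ContDiff ℝ ∞ u) :
    ContDiff ℝ ∞ fun x => Real.exp (-2 * u x) :=
  (contDiff_const.mul hu).exp

theorem contDiff_halfGrad {σ : Matrix (Fin 2) (Fin 2) ℝ} {u : (Fin 2 → ℝ) → ℝ} (hu : ContDiff ℝ ∞ u) :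
    ContDiff ℝ ∞ (halfGrad σ u) :=
  contDiff_pi.2 fun i => ((contDiff_exp_neg hu).mul (contDiff_pi.1 (contDiff_flatGrad hu) i)).neg

theorem contDiff_rho {σ : Matrix (Fin 2) (Fin 2) ℝ} (hσ : σ.PosDef)
    {u : (Fin 2 → ℝ) → ℝ} (hu : ContDiff ℝ ∞ u) : ContDiff ℝ ∞ (rho σ u) := by
  refine ContDiff.sqrt ?_ fun x => ?_
  · exact contDiff_const.add ((contDiff_exp_neg hu).mul (ContDiff.sum fun j _ =>
      (contDiff_pi.1 (contDiff_flatGrad hu) j).mul (contDiff_pd hu j)))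
  · rw [← (rho_sq hσ u x).2]
    exact (pow_pos (rho_sq hσ u x).1 2).ne'

/-- This is half the derivative of `σ(P, P) = e^{-2u} (ρ² - 1)` in the direction `ξ`. It trades
`σ(P, DP ξ)` for the derivative of `ρ`. -/
theorem rho_mul_fderiv_rho {σ : Matrix (Fin 2) (Fin 2) ℝ} (hσ : σ.PosDef)
    {u : (Fin 2 → ℝ) → ℝ} (hu : ContDiff ℝ ∞ u) (x ξ : Fin 2 → ℝ) :
    Real.exp (-2 * u x) * (rho σ u x * fderiv ℝ (rho σ u) x ξ) =
      metricInner σ (halfGrad σ u x) (fderiv ℝ (halfGrad σ u) x ξ) +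
        Real.exp (-2 * u x) * (rho σ u x ^ 2 - 1) * fderiv ℝ u x ξ := by
  have hP : HasFDerivAt (halfGrad σ u) (fderiv ℝ (halfGrad σ u) x) x :=
    ((contDiff_halfGrad hu).differentiable (by simp) x).hasFDerivAt
  have hPi : ∀ i, HasFDerivAt (fun y => halfGrad σ u y i)
      ((ContinuousLinearMap.proj i).comp (fderiv ℝ (halfGrad σ u) x)) x :=
    fun i => hasFDerivAt_pi'.1 hP i
  have hr : HasFDerivAt (rho σ u) (fderiv ℝ (rho σ u) x) x :=
    ((contDiff_rho hσ hu).differentiable (by simp) x).hasFDerivAt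
  have hu' : HasFDerivAt u (fderiv ℝ u x) x := (hu.differentiable (by simp) x).hasFDerivAt
  have hs := symm_of_posDef hσ
  have e : (fun y => σ 0 0 * halfGrad σ u y 0 * halfGrad σ u y 0 +
      σ 0 1 * halfGrad σ u y 0 * halfGrad σ u y 1 + (σ 1 0 * halfGrad σ u y 1 * halfGrad σ u y 0 +
      σ 1 1 * halfGrad σ u y 1 * halfGrad σ u y 1)) =
      fun y => Real.exp (-2 * u y) * (rho σ u y ^ 2 - 1) := by
    funext y
    rw [← metricInner_halfGrad_self hσ, metricInner_two]
  have h1 := (((((hPi 0).const_mul (σ 0 0)).mul (hPi 0)).add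
    (((hPi 0).const_mul (σ 0 1)).mul (hPi 1))).add
    ((((hPi 1).const_mul (σ 1 0)).mul (hPi 0)).add (((hPi 1).const_mul (σ 1 1)).mul (hPi 1))))
  have h2 := (hu'.const_mul (-2)).exp.mul ((hr.pow 2).sub_const 1)
  have h3 := h1.unique (h2.congr_of_eventuallyEq (Eventually.of_forall fun y => congrFun e y))
  have h4 := congrArg (fun L : (Fin 2 → ℝ) →L[ℝ] ℝ => L ξ) h3
  simp at h4
  rw [metricInner_two]
  rw [hs] at h4 ⊢
  simp only [neg_mul]
  linear_combination (-1 / 2) * h4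

/-! ### Christoffel symbols and the second fundamental form of a graph -/

/-- Lowering the index cancels the inverse metric, so the inverse of the Kottler metric never has to
be computed. -/
theorem sum_metric_mul_christoffel {n : ℕ} {g : (Fin n → ℝ) → Matrix (Fin n) (Fin n) ℝ}
    {p : Fin n → ℝ} (hg : ∀ a c, g p a c = g p c a) (hd : (g p).det ≠ 0) (m i j : Fin n) :
    ∑ k, g p k m * christoffel g p k i j = (1 / 2) *
      (pd i (fun q => g q j m) p + pd j (fun q => g q i m) p - pd m (fun q => g q i j) p) := by
  have h : g p * (g p)⁻¹ = 1 := Matrix.mul_nonsing_inv _ hd.isUnit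
  have h' : ∀ l, ∑ k, g p k m * (g p)⁻¹ k l = if m = l then 1 else 0 := fun l => by
    rw [← Matrix.one_apply, ← h, Matrix.mul_apply]
    exact Finset.sum_congr rfl fun k _ => by rw [hg]
  simp only [christoffel, Finset.mul_sum]
  rw [Finset.sum_comm]
  have : ∀ l, ∑ k, g p k m * (1 / 2 * ((g p)⁻¹ k l *
      (pd i (fun q => g q j l) p + pd j (fun q => g q i l) p - pd l (fun q => g q i j) p))) =
      (if m = l then 1 else 0) * (1 / 2 *
      (pd i (fun q => g q j l) p + pd j (fun q => g q i l) p - pd l (fun q => g q i j) p)) :=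
    fun l => by
      rw [← h', Finset.sum_mul]
      exact Finset.sum_congr rfl fun k _ => by ring
  simp only [this]
  simp

theorem pd_kottlerMetric (σ : Matrix (Fin 2) (Fin 2) ℝ) (p : Fin 3 → ℝ) (l a c : Fin 3) :
    pd l (fun q => kottlerMetric σ q a c) p =
      if l = 0 ∧ a ≠ 0 ∧ c ≠ 0 then 2 * kottlerMetric σ p a c else 0 := by
  have h : HasFDerivAt (fun q : Fin 3 → ℝ => Real.exp (2 * q 0))
      (Real.exp (2 * p 0) • (2 : ℝ) • ContinuousLinearMap.proj (R := ℝ) (φ := fun _ => ℝ) 0) p :=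
    ((hasFDerivAt_apply (𝕜 := ℝ) (0 : Fin 3) p).const_mul 2).exp
  have h' : ∀ s, pd l (fun q : Fin 3 → ℝ => Real.exp (2 * q 0) * s) p =
      if l = 0 then 2 * (Real.exp (2 * p 0) * s) else 0 := fun s => by
    rw [pd, (h.mul_const s).fderiv]
    fin_cases l <;> simp
    ring
  have h0 : ∀ s : ℝ, pd l (fun _ : Fin 3 → ℝ => s) p = 0 := fun s => by simp [pd]
  fin_cases a <;> fin_cases c <;> simp [kottlerMetric, h', h0]

theorem kottlerMetric_symm {σ : Matrix (Fin 2) (Fin 2) ℝ} (hσ : σ.PosDef) (p : Fin 3 → ℝ)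
    (a c : Fin 3) : kottlerMetric σ p a c = kottlerMetric σ p c a := by
  fin_cases a <;> fin_cases c <;> simp [kottlerMetric, symm_of_posDef hσ]

theorem det_kottlerMetric_ne_zero {σ : Matrix (Fin 2) (Fin 2) ℝ} (hσ : σ.PosDef)
    (p : Fin 3 → ℝ) : (kottlerMetric σ p).det ≠ 0 := by
  have : (kottlerMetric σ p).det = Real.exp (2 * p 0) ^ 2 * σ.det := by
    rw [Matrix.det_fin_three, Matrix.det_fin_two]
    simp [kottlerMetric]
    ring
  rw [this]
  exact mul_ne_zero (by positivity) hσ.det_pos.ne'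

theorem metricInner_covDerivAlong {m n : ℕ} {g : (Fin n → ℝ) → Matrix (Fin n) (Fin n) ℝ}
    {X N : (Fin m → ℝ) → (Fin n → ℝ)} {x : Fin m → ℝ} (hg : ∀ a c, g (X x) a c = g (X x) c a)
    (hd : (g (X x)).det ≠ 0) (i : Fin m) (W : Fin n → ℝ) :
    metricInner (g (X x)) (covDerivAlong g X N i x) W =
      metricInner (g (X x)) (tangentVec N i x) W +
        ∑ c, ∑ b, ∑ d, (1 / 2) * (pd b (fun q => g q d c) (X x) + pd d (fun q => g q b c) (X x) -
          pd c (fun q => g q b d) (X x)) * tangentVec X i x b * N x d * W c := by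
  simp only [← sum_metric_mul_christoffel hg hd, metricInner, covDerivAlong, Finset.sum_mul,
    Finset.mul_sum, mul_add, add_mul, Finset.sum_add_distrib, tangentVec]
  congr 1
  rw [Finset.sum_comm]
  refine Finset.sum_congr rfl fun c _ => ?_
  rw [Finset.sum_comm]
  refine Finset.sum_congr rfl fun b _ => ?_
  rw [Finset.sum_comm]
  refine Finset.sum_congr rfl fun d _ => Finset.sum_congr rfl fun a _ => ?_
  ring

/-- The normal is `ρ⁻¹ (∂ₛ + P)`. The derivative of the factor `ρ⁻¹` multiplies a vector orthogonal
to the graph and drops out. Of the three Christoffel terms, the two containing `P` cancel because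
`σ(P, ·) = -e^{-2u} du`, and the third gives the identity in `1 + DP`. -/
theorem graphSecondFF_eq {σ : Matrix (Fin 2) (Fin 2) ℝ} (hσ : σ.PosDef)
    {u : (Fin 2 → ℝ) → ℝ} (hu : ContDiff ℝ ∞ u) (x : Fin 2 → ℝ) (i j : Fin 2) :
    graphSecondFF σ u x i j = (rho σ u x)⁻¹ * Real.exp (2 * u x) *
      metricInner σ (Pi.single i 1 + fderiv ℝ (halfGrad σ u) x (Pi.single i 1))
        (Pi.single j 1) := by
  have hP : HasFDerivAt (halfGrad σ u) (fderiv ℝ (halfGrad σ u) x) x :=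
    ((contDiff_halfGrad hu).differentiable (by simp) x).hasFDerivAt
  have hPi : ∀ i, HasFDerivAt (fun y => halfGrad σ u y i)
      ((ContinuousLinearMap.proj i).comp (fderiv ℝ (halfGrad σ u) x)) x :=
    fun i => hasFDerivAt_pi'.1 hP i
  have hr : HasFDerivAt (fun y => (rho σ u y)⁻¹) (fderiv ℝ (fun y => (rho σ u y)⁻¹) x) x :=
    (((contDiff_rho hσ hu).inv fun y => (rho_sq hσ u y).1.ne').differentiable
      (by simp) x).hasFDerivAt
  set r := fun y => (rho σ u y)⁻¹ with hrdef
  have hN0 : pd i (fun y => graphNormal σ u y 0) x = fderiv ℝ r x (Pi.single i 1) := rfl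
  have hNa : ∀ a : Fin 2, pd i (fun y => graphNormal σ u y a.succ) x =
      r x * fderiv ℝ (halfGrad σ u) x (Pi.single i 1) a +
        halfGrad σ u x a * fderiv ℝ r x (Pi.single i 1) := fun a => by
    have h : (fun y => graphNormal σ u y a.succ) = fun y => r y * halfGrad σ u y a := by
      funext y; rw [graphNormal_eq]; rfl
    rw [h, pd, (hr.fun_mul (hPi a)).fderiv]
    simp
  have hN1 := hNa 0
  have hN2 := hNa 1
  have e1 : (Fin.succ 0 : Fin 3) = 1 := rfl
  have e2 : (Fin.succ 1 : Fin 3) = 2 := rfl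
  rw [e1] at hN1
  rw [e2] at hN2
  have hE : Real.exp (2 * u x) * Real.exp (-2 * u x) = 1 := by
    rw [← Real.exp_add]; simp
  have hPj := metricInner_halfGrad hσ u x (Pi.single j 1)
  have hPi' := metricInner_halfGrad hσ u x (Pi.single i 1)
  have hs := symm_of_posDef hσ
  have n0 : graphNormal σ u x 0 = r x := rfl
  have n1 : graphNormal σ u x 1 = r x * halfGrad σ u x 0 := by rw [graphNormal_eq]; rfl
  have n2 : graphNormal σ u x 2 = r x * halfGrad σ u x 1 := by rw [graphNormal_eq]; rfl
  rw [graphSecondFF, secondFundamentalForm, Matrix.of_apply,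
    metricInner_covDerivAlong (kottlerMetric_symm hσ _) (det_kottlerMetric_ne_zero hσ _)]
  simp only [tangentVec_graphParam, pd_kottlerMetric, metricInner, Fin.sum_univ_three,
    Fin.sum_univ_two, n0, n1, n2] at hPj hPi' ⊢
  simp only [tangentVec, hN0, hN1, hN2]
  change _ = r x * _ * _
  change _ = -(_ * pd j u x) at hPj
  change _ = -(_ * pd i u x) at hPi'
  generalize fderiv ℝ r x (Pi.single i 1) = ri at *
  generalize fderiv ℝ (halfGrad σ u) x (Pi.single i 1) = Pd at *
  generalize pd i u x = ui at *
  generalize pd j u x = uj at *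
  have g0 : graphParam u x 0 = u x := rfl
  rw [hs] at hPj hPi'
  simp [kottlerMetric, g0] at hPj hPi' ⊢
  rw [hs]
  simp only [neg_mul] at hE
  generalize Real.exp (2 * u x) = E at *
  linear_combination (E * ri + E * ui * r x) * hPj - r x * uj * E * hPi' - ri * uj * hE

/-- Convexity of the graph of `u` amounts to convexity of `e^{-2u} + |θ|²`. -/
theorem metricInner_convex {σ : Matrix (Fin 2) (Fin 2) ℝ} (hσ : σ.PosDef)
    {u : (Fin 2 → ℝ) → ℝ} (hu : ContDiff ℝ ∞ u) {x : Fin 2 → ℝ}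
    (hh : (graphSecondFF σ u x).PosSemidef) (ξ : Fin 2 → ℝ) :
    0 ≤ metricInner σ (ξ + fderiv ℝ (halfGrad σ u) x ξ) ξ := by
  have h := hh.dotProduct_mulVec_nonneg ξ
  have hr := (rho_sq hσ u x).1
  have hξ : fderiv ℝ (halfGrad σ u) x ξ = ξ 0 • fderiv ℝ (halfGrad σ u) x (Pi.single 0 1) +
      ξ 1 • fderiv ℝ (halfGrad σ u) x (Pi.single 1 1) := by
    have h : ξ = ξ 0 • Pi.single 0 1 + ξ 1 • Pi.single 1 1 := by
      funext i; fin_cases i <;> simp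
    conv_lhs => rw [h]
    simp
  have hc : 0 < (rho σ u x)⁻¹ * Real.exp (2 * u x) := by positivity
  refine nonneg_of_mul_nonneg_right (b := metricInner σ (ξ + fderiv ℝ (halfGrad σ u) x ξ) ξ) ?_ hc
  have hs := symm_of_posDef hσ
  simp only [dotProduct, Matrix.mulVec, Fin.sum_univ_two, Pi.star_apply, star_trivial,
    graphSecondFF_eq hσ hu, metricInner_two] at h
  refine h.trans_eq ?_
  rw [metricInner_two, hξ]
  simp
  ring

/-- The derivative of `x ↦ x + τ / (ρ + τ) P`, where `P` is the half-gradient of `e^{-2u}`, has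
no kernel if the graph of `u` is convex. -/
theorem eq_zero_of_convex {σ : Matrix (Fin 2) (Fin 2) ℝ} (hσ : σ.PosDef)
    {u : (Fin 2 → ℝ) → ℝ} (hu : ContDiff ℝ ∞ u) {x : Fin 2 → ℝ}
    (hh : (graphSecondFF σ u x).PosSemidef) {τ : ℝ} (hτ : 0 ≤ τ) {ξ : Fin 2 → ℝ}
    (h : ξ + (τ / (rho σ u x + τ)) • fderiv ℝ (halfGrad σ u) x ξ -
      (τ / (rho σ u x + τ) ^ 2 * fderiv ℝ (rho σ u) x ξ) • halfGrad σ u x = 0) : ξ = 0 := by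
  have hc := metricInner_convex hσ hu hh ξ
  have h1 := rho_mul_fderiv_rho hσ hu x ξ
  have h2 := metricInner_halfGrad_self hσ u x
  have h3 := metricInner_halfGrad hσ u x ξ
  have hρ := one_le_rho hσ u x
  have hs := symm_of_posDef hσ
  by_contra hne
  have hpos := metricInner_pos hσ hne
  have hQ := Real.exp_pos (-2 * u x)
  generalize fderiv ℝ (halfGrad σ u) x ξ = S at *
  generalize halfGrad σ u x = P at *
  generalize fderiv ℝ (rho σ u) x ξ = δ at *
  generalize fderiv ℝ u x ξ = du at *
  generalize rho σ u x = ρ at *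
  generalize Real.exp (-2 * u x) = Q at *
  have hρτ : 0 < ρ + τ := by linarith
  have key : ∀ i, (ρ + τ) ^ 2 * ξ i + τ * (ρ + τ) * S i - τ * δ * P i = 0 := fun i => by
    have e := congrFun h i
    simp only [Pi.sub_apply, Pi.add_apply, Pi.smul_apply, smul_eq_mul, Pi.zero_apply] at e
    field_simp at e
    linear_combination e
  have e0 := key 0
  have e1 := key 1
  -- The kernel equation is paired with `P` here and with `ξ` in `k2`.
  have k1 : (ρ + τ) ^ 2 * metricInner σ P ξ + τ * (ρ + τ) * metricInner σ P S -
      τ * δ * metricInner σ P P = 0 := by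
    simp only [metricInner_two]
    linear_combination (σ 0 0 * P 0 + σ 1 0 * P 1) * e0 + (σ 0 1 * P 0 + σ 1 1 * P 1) * e1
  have k2 : (ρ + τ) ^ 2 * metricInner σ ξ ξ + τ * (ρ + τ) * metricInner σ S ξ -
      τ * δ * metricInner σ P ξ = 0 := by
    simp only [metricInner_two]
    linear_combination (σ 0 0 * ξ 0 + σ 0 1 * ξ 1) * e0 + (σ 1 0 * ξ 0 + σ 1 1 * ξ 1) * e1
  have hadd : metricInner σ (ξ + S) ξ = metricInner σ ξ ξ + metricInner σ S ξ := by
    simp only [metricInner_two, Pi.add_apply]; ring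
  rw [hadd] at hc
  generalize metricInner σ P ξ = α at *
  generalize metricInner σ P S = β at *
  generalize metricInner σ P P = π at *
  generalize metricInner σ S ξ = γ at *
  generalize metricInner σ ξ ξ = n at *
  -- Eliminating `σ(P, S)` and `σ(P, P)` from `k1` leaves a common factor `1 + τρ > 0`, and
  -- expresses `δ` through `α`.
  have k3 : ρ * α * (ρ + τ) + τ * Q * δ = 0 := by
    have : (1 + τ * ρ) * (ρ * α * (ρ + τ) + τ * Q * δ) = 0 := by
      linear_combination k1 + τ * δ * h2 + τ * (ρ + τ) * h1 + τ * (ρ + τ) * (ρ ^ 2 - 1) * h3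
    exact (mul_eq_zero.1 this).resolve_left (by positivity)
  -- Once `δ` is eliminated from `k2`, the cross term becomes the square `ρα²`. Convexity says `n +
  -- γ ≥ 0`, and `ρn > 0` makes the sum strictly positive.
  have k4 : (ρ + τ) * (Q * (ρ * n + τ * (n + γ)) + ρ * α ^ 2) = 0 := by
    linear_combination Q * k2 + α * k3
  have : 0 < (ρ + τ) * (Q * (ρ * n + τ * (n + γ)) + ρ * α ^ 2) := by
    have hρ0 : 0 < ρ := by linarith
    positivity
  exact this.ne' k4

/-! ### The normal exponential map of a convex graph -/

/-- `u` is a smooth periodic function whose graph in the Kottler manifold is convex. -/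
structure IsConvexGraph (σ : Matrix (Fin 2) (Fin 2) ℝ) (u : (Fin 2 → ℝ) → ℝ) : Prop where
  posDef : σ.PosDef
  contDiff : ContDiff ℝ ∞ u
  periodic : IsPeriodic u
  convex : ∀ x, (graphSecondFF σ u x).PosSemidef

/-- The `θ`-coordinate at time `t` of the normal geodesic that starts over `x`, where
`τ = tanh t`. -/
def footMap (σ : Matrix (Fin 2) (Fin 2) ℝ) (u : (Fin 2 → ℝ) → ℝ) (τ : ℝ) (x : Fin 2 → ℝ) :
    Fin 2 → ℝ :=
  x + (τ / (rho σ u x + τ)) • halfGrad σ u x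

/-- The inverse of `footMap`. -/
def footInv (σ : Matrix (Fin 2) (Fin 2) ℝ) (u : (Fin 2 → ℝ) → ℝ) (τ : ℝ) :
    (Fin 2 → ℝ) → Fin 2 → ℝ :=
  Function.invFun (footMap σ u τ)

/-- The `s`-coordinate at time `t` of the normal geodesic that starts over `x`. -/
def heightAlong (σ : Matrix (Fin 2) (Fin 2) ℝ) (u : (Fin 2 → ℝ) → ℝ) (t : ℝ) (x : Fin 2 → ℝ) : ℝ :=
  u x + Real.log (Real.cosh t + Real.sinh t * (rho σ u x)⁻¹)

/-- The graph function at time `t`. -/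
def graphHeight (σ : Matrix (Fin 2) (Fin 2) ℝ) (u : (Fin 2 → ℝ) → ℝ) (t : ℝ) (y : Fin 2 → ℝ) : ℝ :=
  heightAlong σ u t (footInv σ u (Real.tanh t) y)

theorem IsPeriodic.fderiv {u : (Fin 2 → ℝ) → ℝ} (hp : IsPeriodic u) :
    IsPeriodic (fderiv ℝ u) := fun x k => by
  rw [← fderiv_comp_add_right]
  congr 1
  exact funext fun y => hp y k

theorem IsPeriodic.pd {u : (Fin 2 → ℝ) → ℝ} (hp : IsPeriodic u) (i : Fin 2) :
    IsPeriodic (pd i u) := fun x k => by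
  simp only [KottlerFlow.pd, hp.fderiv x k]

theorem IsPeriodic.flatGrad {σ : Matrix (Fin 2) (Fin 2) ℝ} {u : (Fin 2 → ℝ) → ℝ}
    (hp : IsPeriodic u) : IsPeriodic (flatGrad σ u) := fun x k => by
  funext i
  simp only [KottlerFlow.flatGrad, hp.pd _ x k]

theorem IsPeriodic.rho {σ : Matrix (Fin 2) (Fin 2) ℝ} {u : (Fin 2 → ℝ) → ℝ}
    (hp : IsPeriodic u) : IsPeriodic (rho σ u) := fun x k => by
  simp only [KottlerFlow.rho, hp x k, hp.flatGrad x k, hp.pd _ x k]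

theorem IsPeriodic.halfGrad {σ : Matrix (Fin 2) (Fin 2) ℝ} {u : (Fin 2 → ℝ) → ℝ}
    (hp : IsPeriodic u) : IsPeriodic (halfGrad σ u) := fun x k => by
  funext i
  simp only [KottlerFlow.halfGrad, hp x k, hp.flatGrad x k]

/-! ### The time change `τ = tanh t` -/

theorem tanh_nonneg {t : ℝ} (ht : 0 ≤ t) : 0 ≤ Real.tanh t := by
  rw [Real.tanh_eq_sinh_div_cosh]
  exact div_nonneg (Real.sinh_nonneg_iff.2 ht) (Real.cosh_pos t).le

theorem contDiff_tanh : ContDiff ℝ ∞ Real.tanh := by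
  have : Real.tanh = fun t => Real.sinh t / Real.cosh t :=
    funext Real.tanh_eq_sinh_div_cosh
  rw [this]
  exact Real.contDiff_sinh.div Real.contDiff_cosh fun t => (Real.cosh_pos t).ne'

theorem tendsto_tanh_atTop : Tendsto Real.tanh atTop (𝓝 1) := by
  have h : ∀ t, Real.tanh t = (1 - Real.exp (-2 * t)) / (1 + Real.exp (-2 * t)) := fun t => by
    have e : Real.exp (-2 * t) = Real.exp (-t) * Real.exp (-t) := by
      rw [← Real.exp_add]; ring_nf
    have e' : Real.exp t * Real.exp (-t) = 1 := by rw [← Real.exp_add]; simp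
    have := Real.exp_pos t
    have := Real.exp_pos (-t)
    rw [Real.tanh_eq, e, div_eq_div_iff (by positivity) (by positivity)]
    linear_combination (2 * Real.exp (-t)) * e'
  have h0 : Tendsto (fun t : ℝ => Real.exp (-2 * t)) atTop (𝓝 0) :=
    Real.tendsto_exp_atBot.comp (tendsto_id.const_mul_atTop_of_neg (by norm_num))
  rw [show Real.tanh = _ from funext h]
  have := (h0.const_sub 1).div (h0.const_add 1) (by norm_num)
  simpa [Pi.div_def] using this

namespace IsConvexGraph

variable {σ : Matrix (Fin 2) (Fin 2) ℝ} {u : (Fin 2 → ℝ) → ℝ}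

theorem rho_pos (h : IsConvexGraph σ u) (x : Fin 2 → ℝ) : 0 < rho σ u x :=
  (rho_sq h.posDef u x).1

theorem contDiffAt_footMap (h : IsConvexGraph σ u) {τ : ℝ} (hτ : 0 ≤ τ) (x : Fin 2 → ℝ) :
    ContDiffAt ℝ ∞ (fun p : ℝ × (Fin 2 → ℝ) => footMap σ u p.1 p.2) (τ, x) := by
  have hr : ContDiffAt ℝ ∞ (fun p : ℝ × (Fin 2 → ℝ) => rho σ u p.2) (τ, x) :=
    ((contDiff_rho h.posDef h.contDiff).comp contDiff_snd).contDiffAt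
  have hP : ContDiffAt ℝ ∞ (fun p : ℝ × (Fin 2 → ℝ) => halfGrad σ u p.2) (τ, x) :=
    ((contDiff_halfGrad h.contDiff).comp contDiff_snd).contDiffAt
  have := h.rho_pos x
  exact contDiffAt_snd.add ((contDiffAt_fst.div (hr.add contDiffAt_fst)
    (by simp only; positivity)).smul hP)

theorem contDiff_footMap (h : IsConvexGraph σ u) {τ : ℝ} (hτ : 0 ≤ τ) :
    ContDiff ℝ ∞ (footMap σ u τ) :=
  contDiff_iff_contDiffAt.2 fun x => (h.contDiffAt_footMap hτ x).comp x
    (f := fun y => (τ, y)) (contDiff_const.prodMk contDiff_id).contDiffAt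

theorem fderiv_footMap (h : IsConvexGraph σ u) {τ : ℝ} (hτ : 0 ≤ τ) (x ξ : Fin 2 → ℝ) :
    fderiv ℝ (footMap σ u τ) x ξ =
      ξ + (τ / (rho σ u x + τ)) • fderiv ℝ (halfGrad σ u) x ξ -
        (τ / (rho σ u x + τ) ^ 2 * fderiv ℝ (rho σ u) x ξ) • halfGrad σ u x := by
  have hρ := h.rho_pos x
  have hP : HasFDerivAt (halfGrad σ u) (fderiv ℝ (halfGrad σ u) x) x :=
    ((contDiff_halfGrad h.contDiff).differentiable (by simp) x).hasFDerivAt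
  have hr : HasFDerivAt (rho σ u) (fderiv ℝ (rho σ u) x) x :=
    ((contDiff_rho h.posDef h.contDiff).differentiable (by simp) x).hasFDerivAt
  have hne : rho σ u x + τ ≠ 0 := by positivity
  have hc : HasFDerivAt (fun y => τ / (rho σ u y + τ))
      (τ • (-((rho σ u x + τ) ^ 2)⁻¹ • fderiv ℝ (rho σ u) x)) x := by
    simp only [div_eq_mul_inv]
    exact (((hasDerivAt_inv hne).comp_hasFDerivAt x (hr.add_const τ))).const_mul τ
  have hd := (hasFDerivAt_id x).add (hc.smul hP)
  have : footMap σ u τ = id + (fun y => τ / (rho σ u y + τ)) • halfGrad σ u := rfl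
  rw [this, hd.fderiv]
  ext i
  simp
  field_simp
  ring

theorem fderiv_footMap_ker (h : IsConvexGraph σ u) {τ : ℝ} (hτ : 0 ≤ τ) (x ξ : Fin 2 → ℝ)
    (hξ : fderiv ℝ (footMap σ u τ) x ξ = 0) : ξ = 0 :=
  eq_zero_of_convex h.posDef h.contDiff (h.convex x) hτ ((h.fderiv_footMap hτ x ξ).symm.trans hξ)

theorem footMap_add_intVec (h : IsConvexGraph σ u) (τ : ℝ) (x : Fin 2 → ℝ) (k : Fin 2 → ℤ) :
    footMap σ u τ (x + intVec k) = footMap σ u τ x + intVec k := by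
  simp only [footMap, h.periodic.rho x k, h.periodic.halfGrad x k]
  abel

/-- The range of `τ` includes the value `1`, which no finite time attains. This is what makes the
limiting map a diffeomorphism. -/
theorem bijective_footMap (h : IsConvexGraph σ u) {τ : ℝ} (hτ : 0 ≤ τ) :
    Function.Bijective (footMap σ u τ) :=
  bijective_of_fderiv_ker (h.contDiff_footMap hτ)
    (fun x k => by simp only [h.footMap_add_intVec]; abel) (h.fderiv_footMap_ker hτ)

theorem footInv_footMap (h : IsConvexGraph σ u) {τ : ℝ} (hτ : 0 ≤ τ) (x : Fin 2 → ℝ) :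
    footInv σ u τ (footMap σ u τ x) = x :=
  Function.leftInverse_invFun (h.bijective_footMap hτ).1 x

theorem footMap_footInv (h : IsConvexGraph σ u) {τ : ℝ} (hτ : 0 ≤ τ) (y : Fin 2 → ℝ) :
    footMap σ u τ (footInv σ u τ y) = y :=
  Function.rightInverse_invFun (h.bijective_footMap hτ).2 y

theorem footInv_add_intVec (h : IsConvexGraph σ u) {τ : ℝ} (hτ : 0 ≤ τ) (y : Fin 2 → ℝ)
    (k : Fin 2 → ℤ) : footInv σ u τ (y + intVec k) = footInv σ u τ y + intVec k := by
  apply (h.bijective_footMap hτ).1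
  rw [h.footMap_add_intVec, h.footMap_footInv hτ, h.footMap_footInv hτ]

theorem contDiffOn_footInv (h : IsConvexGraph σ u) :
    ContDiffOn ℝ ∞ (fun p : ℝ × (Fin 2 → ℝ) => footInv σ u p.1 p.2) (Ici 0 ×ˢ univ) := by
  rintro ⟨τ, y⟩ ⟨hτ, -⟩
  have := contDiffWithinAt_inverse_family (A := footMap σ u) (B := footInv σ u) (S := Ici 0)
    (fun τ hτ => h.footInv_footMap hτ) hτ (h.contDiffAt_footMap hτ (footInv σ u τ y))
    (h.fderiv_footMap_ker hτ _)
  rwa [h.footMap_footInv hτ] at this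

theorem contDiff_footInv (h : IsConvexGraph σ u) {τ : ℝ} (hτ : 0 ≤ τ) :
    ContDiff ℝ ∞ (footInv σ u τ) :=
  contDiffOn_univ.1 (h.contDiffOn_footInv.comp (f := fun y => (τ, y))
    (contDiff_const.prodMk contDiff_id).contDiffOn fun _ _ => ⟨hτ, mem_univ _⟩)

theorem cosh_add_pos (h : IsConvexGraph σ u) {t : ℝ} (ht : 0 ≤ t) (x : Fin 2 → ℝ) :
    0 < Real.cosh t + Real.sinh t * (rho σ u x)⁻¹ := by
  have := h.rho_pos x
  have := Real.cosh_pos t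
  have := Real.sinh_nonneg_iff.2 ht
  positivity

theorem contDiffAt_heightAlong (h : IsConvexGraph σ u) {t : ℝ} (ht : 0 ≤ t) (x : Fin 2 → ℝ) :
    ContDiffAt ℝ ∞ (fun p : ℝ × (Fin 2 → ℝ) => heightAlong σ u p.1 p.2) (t, x) := by
  have hr : ContDiffAt ℝ ∞ (fun p : ℝ × (Fin 2 → ℝ) => rho σ u p.2) (t, x) :=
    ((contDiff_rho h.posDef h.contDiff).comp contDiff_snd).contDiffAt
  have hc : ContDiffAt ℝ ∞ (fun p : ℝ × (Fin 2 → ℝ) => Real.cosh p.1) (t, x) :=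
    (Real.contDiff_cosh.comp contDiff_fst).contDiffAt
  have hs : ContDiffAt ℝ ∞ (fun p : ℝ × (Fin 2 → ℝ) => Real.sinh p.1) (t, x) :=
    (Real.contDiff_sinh.comp contDiff_fst).contDiffAt
  exact (h.contDiff.comp contDiff_snd).contDiffAt.add
    ((hc.add (hs.mul (hr.inv (h.rho_pos x).ne'))).log (h.cosh_add_pos ht x).ne')

theorem isPeriodic_heightAlong (h : IsConvexGraph σ u) (t : ℝ) :
    IsPeriodic (heightAlong σ u t) := fun x k => by
  simp only [heightAlong, h.periodic x k, h.periodic.rho x k]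

theorem isPeriodic_graphHeight (h : IsConvexGraph σ u) {t : ℝ} (ht : 0 ≤ t) :
    IsPeriodic (graphHeight σ u t) := fun x k => by
  simp only [graphHeight, h.footInv_add_intVec (tanh_nonneg ht), h.isPeriodic_heightAlong t _ k]

theorem graphHeight_footMap (h : IsConvexGraph σ u) {t : ℝ} (ht : 0 ≤ t) (x : Fin 2 → ℝ) :
    graphHeight σ u t (footMap σ u (Real.tanh t) x) = heightAlong σ u t x := by
  rw [graphHeight, h.footInv_footMap (tanh_nonneg ht)]

theorem contDiffOn_graphHeight (h : IsConvexGraph σ u) :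
    ContDiffOn ℝ ∞ (fun p : ℝ × (Fin 2 → ℝ) => graphHeight σ u p.1 p.2) (Ici 0 ×ˢ univ) := by
  have h1 : ContDiffOn ℝ ∞ (fun p : ℝ × (Fin 2 → ℝ) => heightAlong σ u p.1 p.2)
      (Ici 0 ×ˢ univ) := fun p hp => (h.contDiffAt_heightAlong hp.1 p.2).contDiffWithinAt
  have h2 : ContDiffOn ℝ ∞ (fun p : ℝ × (Fin 2 → ℝ) => footInv σ u (Real.tanh p.1) p.2)
      (Ici 0 ×ˢ univ) :=
    h.contDiffOn_footInv.comp (f := fun p : ℝ × (Fin 2 → ℝ) => (Real.tanh p.1, p.2))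
      ((contDiff_tanh.comp contDiff_fst).prodMk contDiff_snd).contDiffOn
      fun p hp => ⟨tanh_nonneg hp.1, mem_univ _⟩
  exact h1.comp (contDiffOn_fst.prodMk h2) fun p hp => ⟨hp.1, mem_univ _⟩

theorem contDiff_graphHeight (h : IsConvexGraph σ u) {t : ℝ} (ht : 0 ≤ t) :
    ContDiff ℝ ∞ (graphHeight σ u t) :=
  contDiffOn_univ.1 (h.contDiffOn_graphHeight.comp (f := fun y => (t, y))
    (contDiff_const.prodMk contDiff_id).contDiffOn fun _ _ => ⟨ht, mem_univ _⟩)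

theorem fderiv_heightAlong (h : IsConvexGraph σ u) {t : ℝ} (ht : 0 ≤ t) (x ξ : Fin 2 → ℝ) :
    fderiv ℝ (heightAlong σ u t) x ξ = fderiv ℝ u x ξ - Real.sinh t * fderiv ℝ (rho σ u) x ξ /
      (rho σ u x * (rho σ u x * Real.cosh t + Real.sinh t)) := by
  have hρ := h.rho_pos x
  have hr : HasFDerivAt (rho σ u) (fderiv ℝ (rho σ u) x) x :=
    ((contDiff_rho h.posDef h.contDiff).differentiable (by simp) x).hasFDerivAt
  have hu' : HasFDerivAt u (fderiv ℝ u x) x := (h.contDiff.differentiable (by simp) x).hasFDerivAt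
  have hd := hu'.fun_add (((((hasDerivAt_inv hρ.ne').comp_hasFDerivAt x hr).const_mul
    (Real.sinh t)).const_add (Real.cosh t)).log (h.cosh_add_pos ht x).ne')
  rw [show fderiv ℝ (heightAlong σ u t) x = _ from hd.fderiv]
  have := Real.cosh_pos t
  have := Real.sinh_nonneg_iff.2 ht
  simp
  field_simp
  ring

theorem exp_two_heightAlong (h : IsConvexGraph σ u) {t : ℝ} (ht : 0 ≤ t) (x : Fin 2 → ℝ) :
    Real.exp (2 * heightAlong σ u t x) =
      Real.exp (2 * u x) * ((rho σ u x * Real.cosh t + Real.sinh t) / rho σ u x) ^ 2 := by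
  have hρ := h.rho_pos x
  have : 2 * heightAlong σ u t x = 2 * u x +
      (Real.log (Real.cosh t + Real.sinh t * (rho σ u x)⁻¹) +
        Real.log (Real.cosh t + Real.sinh t * (rho σ u x)⁻¹)) := by
    rw [heightAlong]; ring
  rw [this, Real.exp_add, Real.exp_add, Real.exp_log (h.cosh_add_pos ht x)]
  field_simp

/-- The Gauss lemma: the velocity of the normal geodesics is normal to the graph at time `t`. -/
theorem velocity_eq_graphNormal (h : IsConvexGraph σ u) {t : ℝ} (ht : 0 ≤ t) (x : Fin 2 → ℝ) :
    Matrix.vecCons ((rho σ u x * Real.sinh t + Real.cosh t) /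
        (rho σ u x * Real.cosh t + Real.sinh t))
      ((rho σ u x / (rho σ u x * Real.cosh t + Real.sinh t) ^ 2) • halfGrad σ u x) =
      graphNormal σ (graphHeight σ u t) (footMap σ u (Real.tanh t) x) := by
  have hτ := tanh_nonneg ht
  have hρ := h.rho_pos x
  have hc := Real.cosh_pos t
  have hs := Real.sinh_nonneg_iff.2 ht
  have hcs := Real.cosh_sq t
  have hE : Real.exp (2 * u x) * Real.exp (-2 * u x) = 1 := by
    rw [← Real.exp_add]; simp
  have hexp := h.exp_two_heightAlong ht x
  have hPP := metricInner_halfGrad_self h.posDef u x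
  have hD : 0 < rho σ u x * Real.cosh t + Real.sinh t := by positivity
  have g0 : graphParam (graphHeight σ u t) (footMap σ u (Real.tanh t) x) 0 =
      heightAlong σ u t x := h.graphHeight_footMap ht x
  rw [← isUpwardUnitNormal_iff h.posDef]
  refine ⟨fun i => ?_, ?_, ?_⟩
  -- Each coordinate direction is the image of some `ξ` under the derivative of the foot map. The
  -- slope of the evolved graph is then a derivative of `heightAlong`, and the inverse foot map need
  -- not be differentiated explicitly.
  · obtain ⟨e, he⟩ := exists_equiv_of_ker _ (h.fderiv_footMap_ker hτ x)
    obtain ⟨ξ, hξ⟩ := e.surjective (Pi.single i 1)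
    have hξ' : fderiv ℝ (footMap σ u (Real.tanh t)) x ξ = Pi.single i 1 := by rw [← he]; exact hξ
    have hcomp : pd i (graphHeight σ u t) (footMap σ u (Real.tanh t) x) =
        fderiv ℝ (heightAlong σ u t) x ξ := by
      have e1 : graphHeight σ u t ∘ footMap σ u (Real.tanh t) = heightAlong σ u t :=
        funext fun y => h.graphHeight_footMap ht y
      rw [← e1, fderiv_comp x ((h.contDiff_graphHeight ht).differentiable (by simp) _)
        ((h.contDiff_footMap hτ).differentiable (by simp) _), ContinuousLinearMap.comp_apply, hξ']
      rfl
    have hβ := rho_mul_fderiv_rho h.posDef h.contDiff x ξ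
    have hα := metricInner_halfGrad h.posDef u x ξ
    have hτe : Real.tanh t = Real.sinh t / Real.cosh t := Real.tanh_eq_sinh_div_cosh t
    rw [tangentVec_graphParam, metricInner_kottlerMetric, g0, hcomp, hexp,
      h.fderiv_heightAlong ht, ← hξ', h.fderiv_footMap hτ, hτe]
    change _ * _ + _ * metricInner σ (_ • halfGrad σ u x) (_ + _ - _) = 0
    simp only [Matrix.cons_val_zero]
    have hlin : ∀ (k c d : ℝ) (P S : Fin 2 → ℝ), metricInner σ (k • P) (ξ + c • S - d • P) =
        k * (metricInner σ P ξ + c * metricInner σ P S - d * metricInner σ P P) :=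
      fun k c d P S => by simp [metricInner_two]; ring
    rw [hlin, hPP, hα, ← sub_eq_iff_eq_add.2 hβ]
    generalize fderiv ℝ u x ξ = du
    generalize fderiv ℝ (rho σ u) x ξ = δ
    generalize Real.exp (-2 * u x) = Q at *
    generalize Real.exp (2 * u x) = E at *
    generalize rho σ u x = ρ at *
    generalize Real.cosh t = C at *
    generalize Real.sinh t = S at *
    -- The product `E * Q = 1` is isolated, so that what remains is a rational identity in `ρ`, `C`
    -- and `S`.
    have hK : E * ((ρ * C + S) / ρ) ^ 2 * (ρ / (ρ * C + S) ^ 2 * (-(Q * du) +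
        S / C / (ρ + S / C) * (Q * (ρ * δ) - Q * (ρ ^ 2 - 1) * du) -
        S / C / (ρ + S / C) ^ 2 * δ * (Q * (ρ ^ 2 - 1)))) = E * Q * (1 / ρ * (-du +
        S / C / (ρ + S / C) * (ρ * δ - (ρ ^ 2 - 1) * du) -
        S / C / (ρ + S / C) ^ 2 * δ * (ρ ^ 2 - 1))) := by
      field_simp
    have hSC : ρ + S / C = (ρ * C + S) / C := by field_simp
    rw [hK, hE, hSC]
    field_simp
    ring
  · rw [metricInner_kottlerMetric, g0, hexp]
    change _ * _ + _ * metricInner σ (_ • halfGrad σ u x) (_ • halfGrad σ u x) = 1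
    have hlin : ∀ (k : ℝ) (P : Fin 2 → ℝ), metricInner σ (k • P) (k • P) =
        k ^ 2 * metricInner σ P P := fun k P => by simp [metricInner_two]; ring
    simp only [Matrix.cons_val_zero]
    rw [hlin, hPP]
    generalize Real.exp (-2 * u x) = Q at *
    generalize Real.exp (2 * u x) = E at *
    generalize rho σ u x = ρ at *
    generalize Real.cosh t = C at *
    generalize Real.sinh t = S at *
    have hK : E * ((ρ * C + S) / ρ) ^ 2 * ((ρ / (ρ * C + S) ^ 2) ^ 2 * (Q * (ρ ^ 2 - 1))) =
        E * Q * ((ρ ^ 2 - 1) / (ρ * C + S) ^ 2) := by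
      field_simp
    rw [hK, hE]
    field_simp
    linear_combination (1 - ρ ^ 2) * hcs
  · show 0 < (rho σ u x * Real.sinh t + Real.cosh t) / (rho σ u x * Real.cosh t + Real.sinh t)
    positivity

theorem hasDerivAt_heightAlong (h : IsConvexGraph σ u) {t : ℝ} (ht : 0 ≤ t) (x : Fin 2 → ℝ) :
    HasDerivAt (fun t => heightAlong σ u t x) ((rho σ u x * Real.sinh t + Real.cosh t) /
        (rho σ u x * Real.cosh t + Real.sinh t)) t := by
  have hρ := h.rho_pos x
  have hc := Real.cosh_pos t
  have hs := Real.sinh_nonneg_iff.2 ht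
  have := (((Real.hasDerivAt_cosh t).fun_add ((Real.hasDerivAt_sinh t).mul_const (rho σ u x)⁻¹)).log
    (h.cosh_add_pos ht x).ne').const_add (u x)
  refine this.congr_deriv ?_
  field_simp

theorem hasDerivAt_footMap (h : IsConvexGraph σ u) {t : ℝ} (ht : 0 ≤ t) (x : Fin 2 → ℝ) :
    HasDerivAt (fun t => footMap σ u (Real.tanh t) x)
      ((rho σ u x / (rho σ u x * Real.cosh t + Real.sinh t) ^ 2) • halfGrad σ u x) t := by
  have hρ := h.rho_pos x
  have hc := Real.cosh_pos t
  have hs := Real.sinh_nonneg_iff.2 ht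
  have hD : 0 < rho σ u x * Real.cosh t + Real.sinh t := by positivity
  -- In this form the quotient rule has numerator `ρ (cosh² - sinh²) = ρ`.
  have e : ∀ t, Real.tanh t / (rho σ u x + Real.tanh t) =
      Real.sinh t / (rho σ u x * Real.cosh t + Real.sinh t) := fun t => by
    have hc := Real.cosh_pos t
    rw [Real.tanh_eq_sinh_div_cosh, ← mul_div_mul_right _ _ hc.ne', add_mul,
      div_mul_cancel₀ _ hc.ne']
  have hd := (Real.hasDerivAt_sinh t).fun_div
    (((Real.hasDerivAt_cosh t).const_mul (rho σ u x)).fun_add (Real.hasDerivAt_sinh t)) hD.ne'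
  have := (hd.smul_const (halfGrad σ u x)).const_add x
  simp only [footMap, e]
  refine this.congr_deriv ?_
  congr 2
  linear_combination (rho σ u x) * Real.cosh_sq t

end IsConvexGraph

/-! ### The unit normal flow of a convex graph -/

/-- The torus map with the lift `A`. -/
def torusMapOfLift (A : (Fin 2 → ℝ) → Fin 2 → ℝ) : Torus → Torus :=
  descend fun x => torusProj (A x)

theorem torusMapOfLift_torusProj {A : (Fin 2 → ℝ) → Fin 2 → ℝ}
    (hA : ∀ x k, A (x + intVec k) = A x + intVec k) (x : Fin 2 → ℝ) :
    torusMapOfLift A (torusProj x) = torusProj (A x) :=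
  descend_torusProj (f := fun x => torusProj (A x))
    (fun x k => by simp only [hA, torusProj_add_intVec]) x

theorem pullback_descend {f : (Fin 2 → ℝ) → ℝ} (hf : IsPeriodic f) : pullback (descend f) = f :=
  funext fun x => descend_torusProj hf x

/-- The graph function at time `t`, renormalized by `-t`, where `τ = tanh t`. -/
def renormHeight (σ : Matrix (Fin 2) (Fin 2) ℝ) (u : (Fin 2 → ℝ) → ℝ) (τ : ℝ) (y : Fin 2 → ℝ) : ℝ :=
  u (footInv σ u τ y) + Real.log ((rho σ u (footInv σ u τ y) + τ) /
    (rho σ u (footInv σ u τ y) * (1 + τ)))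

namespace IsConvexGraph

variable {σ : Matrix (Fin 2) (Fin 2) ℝ} {u : (Fin 2 → ℝ) → ℝ}

theorem isSmoothLift_footMap (h : IsConvexGraph σ u) {τ : ℝ} (hτ : 0 ≤ τ) :
    IsSmoothLift (footMap σ u τ) (torusMapOfLift (footMap σ u τ)) :=
  ⟨h.contDiff_footMap hτ, fun x => (torusMapOfLift_torusProj (h.footMap_add_intVec τ) x).symm⟩

theorem isTorusDiffeo_footMap (h : IsConvexGraph σ u) {τ : ℝ} (hτ : 0 ≤ τ) :
    IsTorusDiffeo (torusMapOfLift (footMap σ u τ)) := by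
  have h1 := torusMapOfLift_torusProj (h.footMap_add_intVec τ)
  have h2 := torusMapOfLift_torusProj (h.footInv_add_intVec hτ)
  refine ⟨⟨_, h.isSmoothLift_footMap hτ⟩, torusMapOfLift (footInv σ u τ),
    ⟨_, h.contDiff_footInv hτ, fun x => (h2 x).symm⟩, fun θ => ?_, fun θ => ?_⟩
  · obtain ⟨x, rfl⟩ := torusProj_surjective θ
    rw [h1, h2, h.footInv_footMap hτ]
  · obtain ⟨x, rfl⟩ := torusProj_surjective θ
    rw [h2, h1, h.footMap_footInv hτ]

theorem flowMap_torusProj (h : IsConvexGraph σ u) {t : ℝ} (ht : 0 ≤ t) (x : Fin 2 → ℝ) :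
    flowMap (fun t => descend (graphHeight σ u t))
      (fun t => torusMapOfLift (footMap σ u (Real.tanh t))) t (torusProj x) =
      (heightAlong σ u t x, torusProj (footMap σ u (Real.tanh t) x)) := by
  simp only [flowMap, torusMapOfLift_torusProj (h.footMap_add_intVec (Real.tanh t)),
    descend_torusProj (h.isPeriodic_graphHeight ht), h.graphHeight_footMap ht]

theorem isUnitNormalFlow {v₀ : Torus → ℝ} (h : IsConvexGraph σ (pullback v₀)) :
    IsUnitNormalFlow σ v₀ (Ici 0) (fun t => descend (graphHeight σ (pullback v₀) t))
      (fun t => torusMapOfLift (footMap σ (pullback v₀) (Real.tanh t))) where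
  smooth_graph := h.contDiffOn_graphHeight.congr fun p hp =>
    descend_torusProj (h.isPeriodic_graphHeight hp.1) p.2
  diffeo t ht := h.isTorusDiffeo_footMap (tanh_nonneg ht)
  init_graph := by
    funext θ
    obtain ⟨x, rfl⟩ := torusProj_surjective θ
    have := h.graphHeight_footMap le_rfl x
    simp only [footMap, Real.tanh_zero, zero_div, zero_smul, add_zero] at this
    rw [descend_torusProj (h.isPeriodic_graphHeight le_rfl), this]
    simp [heightAlong, pullback]
  init_diffeo := by
    funext θ
    obtain ⟨x, rfl⟩ := torusProj_surjective θ
    rw [torusMapOfLift_torusProj (h.footMap_add_intVec _)]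
    simp [footMap]
  flow := by
    refine ⟨fun t x => Matrix.vecCons (heightAlong σ (pullback v₀) t x)
      (footMap σ (pullback v₀) (Real.tanh t) x), ?_, fun t ht x => ?_, fun t ht x => ?_⟩
    · rintro ⟨t, x⟩ ⟨ht, -⟩
      refine (contDiffAt_pi.2 fun a => ?_).contDiffWithinAt
      refine Fin.cases (h.contDiffAt_heightAlong ht x) (fun i => ?_) a
      have h1 : ContDiffAt ℝ ∞ (fun p : ℝ × (Fin 2 → ℝ) => (Real.tanh p.1, p.2)) (t, x) :=
        ((contDiff_tanh.comp contDiff_fst).prodMk contDiff_snd).contDiffAt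
      exact contDiffAt_pi.1 ((h.contDiffAt_footMap (tanh_nonneg ht) x).comp (t, x) h1) i
    · exact (h.flowMap_torusProj ht x).symm
    · refine HasDerivAt.hasDerivWithinAt ?_
      rw [pullback_descend (h.isPeriodic_graphHeight ht)]
      change HasDerivAt _ (graphNormal σ _ (footMap σ (pullback v₀) (Real.tanh t) x)) t
      rw [← h.velocity_eq_graphNormal ht]
      refine hasDerivAt_pi.2 fun a => ?_
      exact Fin.cases (h.hasDerivAt_heightAlong ht x)
        (fun i => hasDerivAt_pi.1 (h.hasDerivAt_footMap ht x) i) a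

/-! ### Renormalized height and the limit `t → ∞` -/

/-- Writing `t = log (cosh t + sinh t)` merges the logarithms, and dividing by `cosh t` leaves a
function of `tanh t` that still makes sense at `τ = 1`. -/
theorem graphHeight_sub (h : IsConvexGraph σ u) {t : ℝ} (ht : 0 ≤ t) (y : Fin 2 → ℝ) :
    graphHeight σ u t y - t = renormHeight σ u (Real.tanh t) y := by
  rw [graphHeight, renormHeight, heightAlong]
  generalize footInv σ u (Real.tanh t) y = x
  have hρ := h.rho_pos x
  have hpos := h.cosh_add_pos ht x
  have hc := Real.cosh_pos t
  have hs := Real.sinh_nonneg_iff.2 ht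
  have he : t = Real.log (Real.cosh t + Real.sinh t) := by
    rw [Real.cosh_add_sinh, Real.log_exp]
  have : Real.log (Real.cosh t + Real.sinh t * (rho σ u x)⁻¹) - t =
      Real.log ((rho σ u x + Real.tanh t) / (rho σ u x * (1 + Real.tanh t))) := by
    conv_lhs => rw [show Real.log (Real.cosh t + Real.sinh t * (rho σ u x)⁻¹) - t =
      Real.log (Real.cosh t + Real.sinh t * (rho σ u x)⁻¹) -
        Real.log (Real.cosh t + Real.sinh t) by rw [← he]]
    rw [← Real.log_div hpos.ne' (by positivity), Real.tanh_eq_sinh_div_cosh]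
    congr 1
    field_simp
  linarith

theorem isPeriodic_renormHeight (h : IsConvexGraph σ u) {τ : ℝ} (hτ : 0 ≤ τ) :
    IsPeriodic (renormHeight σ u τ) := fun x k => by
  simp only [renormHeight, h.footInv_add_intVec hτ, h.periodic _ k, h.periodic.rho _ k]

/-- For `τ > 0` the one-sided smoothness of `footInv` on `[0, ∞)` is two-sided. The case that
matters is `τ = 1`. -/
theorem contDiffAt_renormHeight (h : IsConvexGraph σ u) {τ : ℝ} (hτ : 0 < τ) (y : Fin 2 → ℝ) :
    ContDiffAt ℝ ∞ (fun p : ℝ × (Fin 2 → ℝ) => renormHeight σ u p.1 p.2) (τ, y) := by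
  have hB : ContDiffAt ℝ ∞ (fun p : ℝ × (Fin 2 → ℝ) => footInv σ u p.1 p.2) (τ, y) :=
    h.contDiffOn_footInv.contDiffAt (prod_mem_nhds (Ici_mem_nhds hτ) univ_mem)
  have hr : ContDiffAt ℝ ∞ (fun p : ℝ × (Fin 2 → ℝ) => rho σ u (footInv σ u p.1 p.2)) (τ, y) :=
    (contDiff_rho h.posDef h.contDiff).contDiffAt.comp (τ, y) hB
  have hu : ContDiffAt ℝ ∞ (fun p : ℝ × (Fin 2 → ℝ) => u (footInv σ u p.1 p.2)) (τ, y) :=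
    h.contDiff.contDiffAt.comp (τ, y) hB
  have hρ := h.rho_pos (footInv σ u τ y)
  refine hu.add (((hr.add contDiffAt_fst).div (hr.mul (contDiffAt_const.add contDiffAt_fst))
    ?_).log ?_)
  · positivity
  · show (rho σ u (footInv σ u τ y) + τ) / (rho σ u (footInv σ u τ y) * (1 + τ)) ≠ 0
    positivity

theorem convergesInC (h : IsConvexGraph σ u) (ℓ : ℕ) :
    ConvergesInC ℓ (fun t θ => descend (graphHeight σ u t) θ - t) (descend (renormHeight σ u 1)) := by
  intro m _ s hs
  have H := tendstoUniformly_iteratedFDeriv (W := renormHeight σ u) (τ₀ := 1) (c := fun _ => 0)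
    (h.contDiffAt_renormHeight one_pos)
    ((lt_mem_nhds one_pos).mono fun τ hτ k x => by
      rw [add_zero]; exact h.isPeriodic_renormHeight hτ.le x k) m s hs
  filter_upwards [tendsto_tanh_atTop.eventually H, eventually_ge_atTop 0] with t ht h0
  have e : pullback (fun θ => descend (graphHeight σ u t) θ - t) =
      renormHeight σ u (Real.tanh t) := funext fun x => by
    rw [← h.graphHeight_sub h0, ← descend_torusProj (h.isPeriodic_graphHeight h0)]
    rfl
  rw [e, pullback_descend (h.isPeriodic_renormHeight zero_le_one)]
  exact ht

theorem smoothFun_renormHeight (h : IsConvexGraph σ u) :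
    SmoothFun (descend (renormHeight σ u 1)) := by
  rw [SmoothFun, pullback_descend (h.isPeriodic_renormHeight zero_le_one)]
  exact contDiff_iff_contDiffAt.2 fun y => (h.contDiffAt_renormHeight one_pos y).comp y
    (f := fun y => ((1 : ℝ), y)) (contDiff_const.prodMk contDiff_id).contDiffAt

theorem convergesSmoothly (h : IsConvexGraph σ u) :
    ConvergesSmoothly (fun t => torusMapOfLift (footMap σ u (Real.tanh t)))
      (torusMapOfLift (footMap σ u 1)) := by
  refine ⟨fun t => footMap σ u (Real.tanh t), footMap σ u 1, ?_,
    h.isSmoothLift_footMap zero_le_one, fun m s hs => ?_⟩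
  · filter_upwards [eventually_ge_atTop 0] with t ht
    exact h.isSmoothLift_footMap (tanh_nonneg ht)
  · exact tendsto_tanh_atTop.eventually (tendstoUniformly_iteratedFDeriv (W := footMap σ u)
      (τ₀ := 1) (c := intVec) (h.contDiffAt_footMap zero_le_one)
      (Eventually.of_forall fun τ k x => h.footMap_add_intVec τ x k) m s hs)

end IsConvexGraph

/-! ### Uniqueness of the unit normal flow -/

theorem metricInner_symm {σ : Matrix (Fin 2) (Fin 2) ℝ} (hσ : σ.PosDef) (V W : Fin 2 → ℝ) :
    metricInner σ V W = metricInner σ W V := by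
  simp only [metricInner_two, symm_of_posDef hσ]; ring

theorem fderiv_eq_exp_mul_metricInner {σ : Matrix (Fin 2) (Fin 2) ℝ} (hσ : σ.PosDef)
    (u : (Fin 2 → ℝ) → ℝ) (x η : Fin 2 → ℝ) :
    fderiv ℝ u x η = -(Real.exp (2 * u x) * metricInner σ (halfGrad σ u x) η) := by
  have hE : Real.exp (2 * u x) * Real.exp (-2 * u x) = 1 := by
    rw [← Real.exp_add]; simp
  rw [metricInner_halfGrad hσ]
  linear_combination (-fderiv ℝ u x η) * hE

theorem hasFDerivAt_metricInner_left (σ : Matrix (Fin 2) (Fin 2) ℝ) {V : Type*}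
    [NormedAddCommGroup V] [NormedSpace ℝ V] {f : V → Fin 2 → ℝ} {f' : V →L[ℝ] Fin 2 → ℝ} {x : V}
    (hf : HasFDerivAt f f' x) (η : Fin 2 → ℝ) :
    ∃ L : V →L[ℝ] ℝ, HasFDerivAt (fun y => metricInner σ (f y) η) L x ∧
      ∀ ξ, L ξ = metricInner σ (f' ξ) η := by
  have hi := hasFDerivAt_pi'.1 hf
  have := (((((hi 0).const_mul (σ 0 0)).mul_const (η 0)).fun_add
    (((hi 0).const_mul (σ 0 1)).mul_const (η 1))).fun_add
    ((((hi 1).const_mul (σ 1 0)).mul_const (η 0)).fun_add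
      (((hi 1).const_mul (σ 1 1)).mul_const (η 1))))
  simp only [← metricInner_two] at this
  refine ⟨_, this, fun ξ => ?_⟩
  rw [metricInner_two]
  simp
  ring

/-- The Hamilton equation for the momentum of the eikonal equation `∂ₜv = ρ`. -/
theorem fderiv_rho_add_fderiv {σ : Matrix (Fin 2) (Fin 2) ℝ} (hσ : σ.PosDef)
    {u : (Fin 2 → ℝ) → ℝ} (hu : ContDiff ℝ ∞ u) (x ξ : Fin 2 → ℝ) :
    fderiv ℝ (fun y => rho σ u y + fderiv ℝ u y ((rho σ u x)⁻¹ • halfGrad σ u x)) x ξ =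
      -((rho σ u x ^ 2 - 1) * (rho σ u x)⁻¹ * fderiv ℝ u x ξ) := by
  have hρ := (rho_sq hσ u x).1
  set η := (rho σ u x)⁻¹ • halfGrad σ u x with hη
  have hP : HasFDerivAt (halfGrad σ u) (fderiv ℝ (halfGrad σ u) x) x :=
    ((contDiff_halfGrad hu).differentiable (by simp) x).hasFDerivAt
  have hr : HasFDerivAt (rho σ u) (fderiv ℝ (rho σ u) x) x :=
    ((contDiff_rho hσ hu).differentiable (by simp) x).hasFDerivAt
  have hu' : HasFDerivAt u (fderiv ℝ u x) x := (hu.differentiable (by simp) x).hasFDerivAt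
  obtain ⟨L, hL, hLξ⟩ := hasFDerivAt_metricInner_left σ hP η
  have hd := hr.fun_add (((hu'.const_mul 2).exp.fun_mul hL).fun_neg)
  -- With `η` frozen at its value at `x`, second derivatives of `u` enter only through `σ(DP ξ, P)`.
  -- This term cancels against the derivative of `ρ`, which is why a multiple of `du` alone
  -- survives.
  simp only [← fderiv_eq_exp_mul_metricInner hσ] at hd
  rw [hd.fderiv]
  have hE : Real.exp (2 * u x) * Real.exp (-2 * u x) = 1 := by
    rw [← Real.exp_add]; simp
  have h1 := rho_mul_fderiv_rho hσ hu x ξ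
  have h2 := metricInner_halfGrad_self hσ u x
  have hsm : ∀ W, metricInner σ W η = (rho σ u x)⁻¹ * metricInner σ (halfGrad σ u x) W :=
    fun W => by rw [metricInner_symm hσ, hη]; simp [metricInner_two]; ring
  simp only [add_apply, neg_apply, smul_apply, smul_eq_mul, hLξ, hsm, h2]
  generalize metricInner σ (halfGrad σ u x) (fderiv ℝ (halfGrad σ u) x ξ) = β at *
  generalize fderiv ℝ u x ξ = du at *
  generalize fderiv ℝ (rho σ u) x ξ = δ at *
  generalize Real.exp (-2 * u x) = Q at *
  generalize Real.exp (2 * u x) = E at *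
  generalize rho σ u x = ρ at *
  field_simp
  linear_combination E * h1 - (ρ * δ + (ρ ^ 2 - 1) * du) * hE

/-! ### Characteristics of the eikonal equation -/

theorem contDiffAt_of_mem_Ioo {T : ℝ} {V : ℝ → (Fin 2 → ℝ) → ℝ}
    (hV : ContDiffOn ℝ ∞ (fun p : ℝ × (Fin 2 → ℝ) => V p.1 p.2) (Ico 0 T ×ˢ univ))
    {t : ℝ} (ht : t ∈ Ioo 0 T) (y : Fin 2 → ℝ) :
    ContDiffAt ℝ ∞ (fun p : ℝ × (Fin 2 → ℝ) => V p.1 p.2) (t, y) :=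
  hV.contDiffAt (prod_mem_nhds (Ico_mem_nhds ht.1 ht.2) univ_mem)

theorem contDiff_slice {T : ℝ} {V : ℝ → (Fin 2 → ℝ) → ℝ}
    (hV : ContDiffOn ℝ ∞ (fun p : ℝ × (Fin 2 → ℝ) => V p.1 p.2) (Ico 0 T ×ˢ univ))
    {t : ℝ} (ht : t ∈ Ico 0 T) : ContDiff ℝ ∞ (V t) :=
  contDiffOn_univ.1 (hV.comp (f := fun y => (t, y))
    (contDiff_const.prodMk contDiff_id).contDiffOn fun _ _ => ⟨ht, mem_univ _⟩)

/-- The spatial derivative is read off from the derivative within `[0, T) × ℝ²`, which is continuous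
up to `t = 0`. -/
theorem continuousOn_fderiv_slice {T : ℝ} {V : ℝ → (Fin 2 → ℝ) → ℝ}
    (hV : ContDiffOn ℝ ∞ (fun p : ℝ × (Fin 2 → ℝ) => V p.1 p.2) (Ico 0 T ×ˢ univ))
    (ξ : Fin 2 → ℝ) :
    ContinuousOn (fun p : ℝ × (Fin 2 → ℝ) => fderiv ℝ (V p.1) p.2 ξ) (Ico 0 T ×ˢ univ) := by
  have h1 := (hV.continuousOn_fderivWithin ((uniqueDiffOn_Ico 0 T).prod uniqueDiffOn_univ)
    (by simp)).clm_apply (continuousOn_const (c := ((0 : ℝ), ξ)))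
  refine h1.congr ?_
  rintro ⟨t, y⟩ ⟨ht, -⟩
  have hd := ((hV (t, y) ⟨ht, mem_univ _⟩).differentiableWithinAt (by simp)).hasFDerivWithinAt
  have h2 : HasFDerivAt (V t) _ y :=
    hd.comp_hasFDerivAt (f := fun x => (t, x)) y (hasFDerivAt_prodMk_right t y)
      (Eventually.of_forall fun _ => ⟨ht, mem_univ _⟩)
  simp only [h2.fderiv]
  simp

theorem fderiv_apply_of_mem_Ioo {T : ℝ} {V : ℝ → (Fin 2 → ℝ) → ℝ}
    (hV : ContDiffOn ℝ ∞ (fun p : ℝ × (Fin 2 → ℝ) => V p.1 p.2) (Ico 0 T ×ˢ univ))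
    {t : ℝ} (ht : t ∈ Ioo 0 T) (y : Fin 2 → ℝ) (a : ℝ)
    (ξ : Fin 2 → ℝ) {c : ℝ} (hc : HasDerivAt (fun τ => V τ y) c t) :
    fderiv ℝ (fun p : ℝ × (Fin 2 → ℝ) => V p.1 p.2) (t, y) (a, ξ) =
      a * c + fderiv ℝ (V t) y ξ := by
  have hd := ((contDiffAt_of_mem_Ioo hV ht y).differentiableAt (by simp)).hasFDerivAt
  have h1 : HasFDerivAt (V t) _ y :=
    hd.comp (f := fun x => (t, x)) y (hasFDerivAt_prodMk_right t y)
  have h2 : HasFDerivAt (fun τ => V τ y) _ t :=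
    hd.comp (f := fun τ => (τ, y)) t (hasFDerivAt_prodMk_left t y)
  have h3 : ((a, ξ) : ℝ × (Fin 2 → ℝ)) = a • (1, 0) + (0, ξ) := by simp
  rw [h3, map_add, map_smul, h1.fderiv, hc.unique h2.hasDerivAt]
  simp

/-- Both sides are the second derivative of `V` in the space-time directions `(1, η)` and `(0, ξ)`,
so symmetry identifies them. By the equation, the first derivative in the direction `(1, η)` is `ρ +
dV(η)`. -/
theorem hasDerivAt_fderiv_along {T : ℝ} {V : ℝ → (Fin 2 → ℝ) → ℝ}
    (hV : ContDiffOn ℝ ∞ (fun p : ℝ × (Fin 2 → ℝ) => V p.1 p.2) (Ico 0 T ×ˢ univ))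
    {σ : Matrix (Fin 2) (Fin 2) ℝ}
    (hpde : ∀ t ∈ Ioo 0 T, ∀ y, HasDerivAt (fun τ => V τ y) (rho σ (V t) y) t)
    {θ : ℝ → Fin 2 → ℝ} {t : ℝ} (ht : t ∈ Ioo 0 T) {η : Fin 2 → ℝ}
    (hθ : HasDerivAt θ η t) (ξ : Fin 2 → ℝ) :
    HasDerivAt (fun τ => fderiv ℝ (V τ) (θ τ) ξ)
      (fderiv ℝ (fun y => rho σ (V t) y + fderiv ℝ (V t) y η) (θ t) ξ) t := by
  set Φ : ℝ × (Fin 2 → ℝ) → ℝ := fun p => V p.1 p.2 with hΦ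
  have hs := contDiffAt_of_mem_Ioo hV ht (θ t)
  have hD : HasFDerivAt (fderiv ℝ Φ) (fderiv ℝ (fderiv ℝ Φ) (t, θ t)) (t, θ t) :=
    ((hs.fderiv_right (m := ∞) (by simp)).differentiableAt (by simp)).hasFDerivAt
  have hsymm : IsSymmSndFDerivAt ℝ Φ (t, θ t) := hs.isSymmSndFDerivAt
    (by rw [minSmoothness_of_isRCLikeNormedField]; exact WithTop.coe_le_coe.2 (le_top : (2 : ℕ∞) ≤ ⊤))
  have hc : HasDerivAt (fun τ => (τ, θ τ)) (1, η) t := (hasDerivAt_id t).prodMk hθ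
  have h1 := (hD.comp_hasDerivAt (f := fun τ => (τ, θ τ)) t hc).clm_apply
    (hasDerivAt_const t ((0 : ℝ), ξ))
  have h2 := (hD.comp (f := fun y => (t, y)) (θ t) (hasFDerivAt_prodMk_right t (θ t))).clm_apply
    (hasFDerivAt_const ((1 : ℝ), η) (θ t))
  have e2 : (fun y => rho σ (V t) y + fderiv ℝ (V t) y η) =
      fun y => (fderiv ℝ Φ ∘ fun y => (t, y)) y (1, η) := funext fun y => by
    simp only [Function.comp_apply]
    rw [fderiv_apply_of_mem_Ioo hV ht y 1 η (hpde t ht y), one_mul]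
  rw [e2, h2.fderiv]
  refine (h1.congr_of_eventuallyEq ?_).congr_deriv ?_
  · filter_upwards [Ioo_mem_nhds ht.1 ht.2] with τ hτ
    simp only [Function.comp_apply]
    rw [fderiv_apply_of_mem_Ioo hV hτ (θ τ) 0 ξ (hpde τ hτ _), zero_mul, zero_add]
  · simpa using hsymm (1, η) (0, ξ)

/-- The characteristics of a solution of the eikonal equation `∂ₜV = ρ` are the normal geodesics
of the initial graph. -/
theorem characteristic_eq {T : ℝ} {V : ℝ → (Fin 2 → ℝ) → ℝ}
    (hV : ContDiffOn ℝ ∞ (fun p : ℝ × (Fin 2 → ℝ) => V p.1 p.2) (Ico 0 T ×ˢ univ))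
    {σ : Matrix (Fin 2) (Fin 2) ℝ} (h : IsConvexGraph σ (V 0))
    (hpde : ∀ t ∈ Ioo 0 T, ∀ y, HasDerivAt (fun τ => V τ y) (rho σ (V t) y) t)
    {θ : ℝ → Fin 2 → ℝ} (hθ : ∀ t ∈ Ico 0 T, HasDerivWithinAt θ
      ((rho σ (V t) (θ t))⁻¹ • halfGrad σ (V t) (θ t)) (Ico 0 T) t) {t : ℝ} (ht : t ∈ Ico 0 T) :
    V t (θ t) = heightAlong σ (V 0) t (θ 0) ∧ θ t = footMap σ (V 0) (Real.tanh t) (θ 0) := by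
  have hθ' : ∀ t ∈ Ioo 0 T,
      HasDerivAt θ ((rho σ (V t) (θ t))⁻¹ • halfGrad σ (V t) (θ t)) t := fun t ht =>
    (hθ t (Ioo_subset_Ico_self ht)).hasDerivAt (Ico_mem_nhds ht.1 ht.2)
  set s : ℝ → ℝ := fun t => V t (θ t) with hs
  set R : ℝ → ℝ := fun t => rho σ (V t) (θ t) with hR
  set q : Fin 2 → ℝ → ℝ := fun j t => pd j (V t) (θ t) with hq
  set g : Fin 2 → ℝ → ℝ := fun i t => flatGrad σ (V t) (θ t) i with hg
  have hgq : ∀ i, g i = fun t => σ⁻¹ i 0 * q 0 t + σ⁻¹ i 1 * q 1 t := fun i => by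
    funext t; simp only [hg, flatGrad, Fin.sum_univ_two, hq]
  -- Expressing `R` through height and momentum gives its continuity up to `t = 0` and closes the
  -- system of ordinary differential equations.
  have hRq : R = fun t => Real.sqrt (1 + Real.exp (-2 * s t) * (g 0 t * q 0 t + g 1 t * q 1 t)) :=
    funext fun t => by simp only [hR, rho, Fin.sum_univ_two, hs, hg, hq]
  have hRpos : ∀ t, 0 < R t := fun t => (rho_sq h.posDef _ _).1
  have hRsq : ∀ t, R t ^ 2 = 1 + Real.exp (-2 * s t) * (g 0 t * q 0 t + g 1 t * q 1 t) :=
    fun t => by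
      have := (rho_sq h.posDef (V t) (θ t)).2
      rwa [Fin.sum_univ_two] at this
  have hcurve : ContinuousOn (fun t => (t, θ t)) (Ico 0 T) :=
    continuousOn_id.prodMk fun t ht => (hθ t ht).continuousWithinAt
  have hmaps : MapsTo (fun t => (t, θ t)) (Ico 0 T) (Ico 0 T ×ˢ univ) :=
    fun t ht => ⟨ht, mem_univ _⟩
  have hsc : ContinuousOn s (Ico 0 T) := hV.continuousOn.comp hcurve hmaps
  have hqc : ∀ j, ContinuousOn (q j) (Ico 0 T) := fun j =>
    (continuousOn_fderiv_slice hV (Pi.single j 1)).comp hcurve hmaps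
  have hgc : ∀ i, ContinuousOn (g i) (Ico 0 T) := fun i => by
    rw [hgq]
    exact ((hqc 0).const_mul _).add ((hqc 1).const_mul _)
  have hRc : ContinuousOn R (Ico 0 T) := by
    rw [hRq]
    exact (continuousOn_const.add ((hsc.const_mul _).rexp.mul
      (((hgc 0).mul (hqc 0)).add ((hgc 1).mul (hqc 1))))).sqrt
  have hrc : ContinuousOn (fun t => (R t)⁻¹) (Ico 0 T) := hRc.inv₀ fun t _ => (hRpos t).ne'
  have hsd : ∀ t ∈ Ioo 0 T, HasDerivAt s (R t)⁻¹ t := fun t ht => by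
    have hd := ((contDiffAt_of_mem_Ioo hV ht (θ t)).differentiableAt (by simp)).hasFDerivAt
    have h1 := hd.comp_hasDerivAt (f := fun τ => (τ, θ τ)) t ((hasDerivAt_id t).prodMk (hθ' t ht))
    refine h1.congr_deriv ?_
    have hE : Real.exp (2 * s t) * Real.exp (-2 * s t) = 1 := by
      rw [← Real.exp_add]; simp
    rw [fderiv_apply_of_mem_Ioo hV ht _ _ _ (hpde t ht _), map_smul, smul_eq_mul,
      fderiv_eq_exp_mul_metricInner h.posDef, metricInner_halfGrad_self h.posDef]
    change 1 * R t + (R t)⁻¹ * -(Real.exp (2 * s t) * (Real.exp (-2 * s t) * (R t ^ 2 - 1))) = _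
    have := hRpos t
    generalize Real.exp (-2 * s t) = Q at *
    field_simp
    linear_combination (1 - R t ^ 2) * hE
  have hqd : ∀ j, ∀ t ∈ Ioo 0 T, HasDerivAt (q j) (-((R t ^ 2 - 1) * (R t)⁻¹ * q j t)) t :=
    fun j t ht => by
      have := hasDerivAt_fderiv_along hV hpde ht (hθ' t ht) (Pi.single j 1)
      rwa [fderiv_rho_add_fderiv h.posDef (contDiff_slice hV (Ioo_subset_Ico_self ht))] at this
  have hgd : ∀ i, ∀ t ∈ Ioo 0 T, HasDerivAt (g i) (-((R t ^ 2 - 1) * (R t)⁻¹ * g i t)) t :=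
    fun i t ht => by
      have := ((hqd 0 t ht).const_mul (σ⁻¹ i 0)).fun_add ((hqd 1 t ht).const_mul (σ⁻¹ i 1))
      rw [← hgq] at this
      refine this.congr_deriv ?_
      simp only [hgq]
      ring
  have hRd : ∀ t ∈ Ioo 0 T, HasDerivAt R (-(R t ^ 2 - 1)) t := fun t ht => by
    have := ((((hsd t ht).const_mul (-2)).exp.fun_mul (((hgd 0 t ht).fun_mul (hqd 0 t ht)).fun_add
      ((hgd 1 t ht).fun_mul (hqd 1 t ht)))).const_add 1).sqrt
      (by rw [← hRsq]; exact (pow_pos (hRpos t) 2).ne')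
    rw [← hRq, ← congrFun hRq t] at this
    refine this.congr_deriv ?_
    have h1 := hRsq t
    have := hRpos t
    generalize Real.exp (-2 * s t) = Q at *
    field_simp
    linear_combination 2 * R t ^ 2 * h1
  have hrd : ∀ t ∈ Ioo 0 T, HasDerivAt (fun t => (R t)⁻¹) (1 - (R t)⁻¹ ^ 2) t := fun t ht => by
    refine ((hRd t ht).fun_inv (hRpos t).ne').congr_deriv ?_
    have := hRpos t
    field_simp
  -- With `r = R⁻¹`, the system `s' = r`, `r' = 1 - r²` makes `eˢ (1 ± r)` grow like `e^{±t}`. This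
  -- gives the conserved quantities in `k1` and `k2`. In `k3` the logarithmic derivatives of `r` and
  -- `g` cancel.
  have k1 : ∀ t ∈ Ico 0 T, Real.exp (-t) * (Real.exp (s t) * (1 + (R t)⁻¹)) =
      Real.exp (s 0) * (1 + (R 0)⁻¹) := fun t ht => by
    have := eq_of_hasDerivAt_zero (f := fun t => Real.exp (-t) * (Real.exp (s t) * (1 + (R t)⁻¹)))
      (continuousOn_id.neg.rexp.mul (hsc.rexp.mul (continuousOn_const.add hrc))) (fun t ht => by
        refine ((hasDerivAt_id t).fun_neg.exp.fun_mul ((hsd t ht).exp.fun_mul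
          ((hrd t ht).const_add 1))).congr_deriv ?_
        simp only [id]
        ring) ht
    simpa using this
  have k2 : ∀ t ∈ Ico 0 T, Real.exp t * (Real.exp (s t) * (1 - (R t)⁻¹)) =
      Real.exp (s 0) * (1 - (R 0)⁻¹) := fun t ht => by
    have := eq_of_hasDerivAt_zero (f := fun t => Real.exp t * (Real.exp (s t) * (1 - (R t)⁻¹)))
      (continuousOn_id.rexp.mul (hsc.rexp.mul (continuousOn_const.sub hrc))) (fun t ht => by
        refine ((Real.hasDerivAt_exp t).fun_mul ((hsd t ht).exp.fun_mul
          ((hrd t ht).const_sub 1))).congr_deriv ?_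
        ring) ht
    simpa using this
  have k3 : ∀ i, ∀ t ∈ Ico 0 T, (R t)⁻¹ * g i t = (R 0)⁻¹ * g i 0 := fun i t ht =>
    eq_of_hasDerivAt_zero (f := fun t => (R t)⁻¹ * g i t) (hrc.mul (hgc i)) (fun t ht => by
      refine ((hrd t ht).fun_mul (hgd i t ht)).congr_deriv ?_
      have := hRpos t
      field_simp
      ring) ht
  have hst : ∀ t ∈ Ico 0 T, s t = heightAlong σ (V 0) t (θ 0) := fun t ht => by
    -- Half the sum of the two exponential laws, in which `r` cancels.
    have e : Real.exp (s t) = Real.exp (s 0) * (Real.cosh t + Real.sinh t * (R 0)⁻¹) := by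
      have ee : Real.exp t * Real.exp (-t) = 1 := by rw [← Real.exp_add]; simp
      rw [Real.cosh_eq, Real.sinh_eq]
      linear_combination (Real.exp t / 2) * k1 t ht + (Real.exp (-t) / 2) * k2 t ht -
        Real.exp (s t) * ee
    rw [heightAlong, ← Real.log_exp (s t), e, Real.log_mul (Real.exp_pos _).ne'
      (h.cosh_add_pos ht.1 _).ne', Real.log_exp]
  refine ⟨hst t ht, funext fun i => sub_eq_zero.1 ?_⟩
  have h0 : θ 0 i - footMap σ (V 0) (Real.tanh 0) (θ 0) i = 0 := by simp [footMap]
  -- The velocity of `θ` is `-e^{-2s} R⁻¹ g`. Here `s` is now explicit and `R⁻¹ g` is conserved, so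
  -- it equals the velocity of the foot map.
  refine (eq_of_hasDerivAt_zero (f := fun t => θ t i - footMap σ (V 0) (Real.tanh t) (θ 0) i)
    (fun t ht => (hasDerivWithinAt_pi.1 (hθ t ht) i).continuousWithinAt.sub
      (hasDerivAt_pi.1 (h.hasDerivAt_footMap ht.1 (θ 0)) i).continuousAt.continuousWithinAt)
    (fun t ht => ?_) ht).trans h0
  refine ((hasDerivAt_pi.1 (hθ' t ht) i).fun_sub
    (hasDerivAt_pi.1 (h.hasDerivAt_footMap ht.1.le (θ 0)) i)).congr_deriv ?_
  have e2 := h.exp_two_heightAlong ht.1.le (θ 0)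
  rw [← hst t (Ioo_subset_Ico_self ht)] at e2
  change (R t)⁻¹ * -(Real.exp (-2 * s t) * g i t) - R 0 / (R 0 * Real.cosh t + Real.sinh t) ^ 2 *
    -(Real.exp (-2 * s 0) * g i 0) = 0
  change _ = Real.exp (2 * s 0) * ((R 0 * Real.cosh t + Real.sinh t) / R 0) ^ 2 at e2
  have e3 : ∀ a : ℝ, Real.exp (-2 * a) = (Real.exp (2 * a))⁻¹ := fun a => by
    rw [← Real.exp_neg]; ring_nf
  have k := k3 i t (Ioo_subset_Ico_self ht)
  have p1 := hRpos 0
  have p2 := Real.cosh_pos t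
  have p3 := Real.sinh_nonneg_iff.2 ht.1.le
  have p4 : 0 < R 0 * Real.cosh t + Real.sinh t := by positivity
  have p5 : (R t)⁻¹ * -(Real.exp (-2 * s t) * g i t) =
      -(Real.exp (-2 * s t) * ((R 0)⁻¹ * g i 0)) := by rw [← k]; ring
  rw [p5, e3, e3, e2]
  generalize R 0 * Real.cosh t + Real.sinh t = D at *
  field_simp
  ring

/-- The curve is the torus part of the lift of `F`. Since `F` stays on the graph, the `s`-part of
the lift is the graph function along this curve. -/
theorem IsUnitNormalFlow.exists_curve {σ : Matrix (Fin 2) (Fin 2) ℝ} {v₀ : Torus → ℝ} {I : Set ℝ}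
    {v : ℝ → Torus → ℝ} {Θ : ℝ → Torus → Torus} (hF : IsUnitNormalFlow σ v₀ I v Θ)
    (x : Fin 2 → ℝ) :
    ∃ θ : ℝ → Fin 2 → ℝ, (∀ t ∈ I, torusProj (θ t) = Θ t (torusProj x)) ∧
      (∀ t ∈ I, HasDerivWithinAt θ
        ((rho σ (pullback (v t)) (θ t))⁻¹ • halfGrad σ (pullback (v t)) (θ t)) I t) ∧
      ∀ t ∈ I, HasDerivWithinAt (fun τ => pullback (v τ) (θ τ))
        (rho σ (pullback (v t)) (θ t))⁻¹ I t := by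
  obtain ⟨G, -, hGp, hGd⟩ := hF.flow
  have hproj : ∀ t ∈ I, torusProj (Matrix.vecTail (G t x)) = Θ t (torusProj x) := fun t ht =>
    congrArg Prod.snd (hGp t ht x)
  refine ⟨fun t => Matrix.vecTail (G t x), hproj, fun t ht => ?_, fun t ht => ?_⟩
  · have := hGd t ht x
    rw [graphNormal_eq] at this
    exact hasDerivWithinAt_pi.2 fun i => hasDerivWithinAt_pi.1 this i.succ
  · have hs : ∀ τ ∈ I, pullback (v τ) (Matrix.vecTail (G τ x)) = G τ x 0 := fun τ hτ => by
      rw [pullback, hproj τ hτ]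
      exact (congrArg Prod.fst (hGp τ hτ x)).symm
    exact (hasDerivWithinAt_pi.1 (hGd t ht x) 0).congr hs (hs t ht)

/-- The graph functions of a unit normal flow solve the eikonal equation `∂ₜv = ρ`. -/
theorem IsUnitNormalFlow.hasDerivAt_graph {σ : Matrix (Fin 2) (Fin 2) ℝ} (hσ : σ.PosDef)
    {v₀ : Torus → ℝ} {T : ℝ} {v : ℝ → Torus → ℝ} {Θ : ℝ → Torus → Torus}
    (hF : IsUnitNormalFlow σ v₀ (Ico 0 T) v Θ) {t : ℝ} (ht : t ∈ Ioo 0 T) (y : Fin 2 → ℝ) :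
    HasDerivAt (fun τ => pullback (v τ) y) (rho σ (pullback (v t)) y) t := by
  have ht' := Ioo_subset_Ico_self ht
  have hn : Ico 0 T ∈ 𝓝 t := Ico_mem_nhds ht.1 ht.2
  obtain ⟨-, Ψ, -, -, hΨ⟩ := hF.diffeo t ht'
  -- Surjectivity of `Θ t` puts a flow curve over `y` at time `t`, up to an integer translation.
  obtain ⟨ϑ, hϑ⟩ := hΨ.surjective (torusProj y)
  obtain ⟨x, rfl⟩ := torusProj_surjective ϑ
  obtain ⟨θ, hθp, hθd, hsd⟩ := hF.exists_curve x
  obtain ⟨k, hk⟩ := torusProj_eq_iff.1 (hϑ.symm.trans (hθp t ht').symm)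
  have hV := contDiffAt_of_mem_Ioo (V := fun t => pullback (v t)) hF.smooth_graph ht (θ t)
  have hd := (hV.differentiableAt (by simp)).hasFDerivAt
  have hc : HasDerivAt (fun τ => pullback (v τ) (θ t)) _ t :=
    (hd.comp (f := fun τ => (τ, θ t)) t (hasFDerivAt_prodMk_left t (θ t))).hasDerivAt
  -- The chain rule gives `∂ₜv + ρ⁻¹ dv(P) = ρ⁻¹`, and `dv(P) = -(ρ² - 1)`; hence `∂ₜv = ρ`.
  have h1 := (hd.comp_hasDerivAt (f := fun τ => (τ, θ τ)) t ((hasDerivAt_id t).prodMk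
    ((hθd t ht').hasDerivAt hn))).unique ((hsd t ht').hasDerivAt hn)
  rw [fderiv_apply_of_mem_Ioo (V := fun t => pullback (v t)) hF.smooth_graph ht _ _ _ hc, map_smul, smul_eq_mul,
    fderiv_eq_exp_mul_metricInner hσ, metricInner_halfGrad_self hσ] at h1
  have hper : ∀ τ, pullback (v τ) (θ t) = pullback (v τ) y := fun τ => by
    rw [hk, isPeriodic_pullback]
  have hρ : rho σ (pullback (v t)) (θ t) = rho σ (pullback (v t)) y := by
    rw [hk, (isPeriodic_pullback (v t)).rho]
  simp only [hper] at hc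
  refine hc.congr_deriv ?_
  rw [← hρ]
  have hE : Real.exp (2 * pullback (v t) (θ t)) * Real.exp (-2 * pullback (v t) (θ t)) = 1 := by
    rw [← Real.exp_add]; simp
  have hpos := (rho_sq hσ (pullback (v t)) (θ t)).1
  have hr := inv_mul_cancel₀ hpos.ne'
  generalize rho σ (pullback (v t)) (θ t) = ρ at *
  linear_combination h1 + ρ⁻¹ * (ρ ^ 2 - 1) * hE + ρ * hr

theorem IsUnitNormalFlow.eq_of_convex {σ : Matrix (Fin 2) (Fin 2) ℝ} {v₀ : Torus → ℝ}
    (h : IsConvexGraph σ (pullback v₀)) {T : ℝ} {v : ℝ → Torus → ℝ}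
    {Θ : ℝ → Torus → Torus} (hF : IsUnitNormalFlow σ v₀ (Ico 0 T) v Θ) {t : ℝ}
    (ht : t ∈ Ico 0 T) :
    v t = descend (graphHeight σ (pullback v₀) t) ∧
      Θ t = torusMapOfLift (footMap σ (pullback v₀) (Real.tanh t)) := by
  have h0 : (0 : ℝ) ∈ Ico 0 T := ⟨le_rfl, ht.1.trans_lt ht.2⟩
  have hL := torusMapOfLift_torusProj (h.footMap_add_intVec (Real.tanh t))
  have key : ∀ x, Θ t (torusProj x) =
      torusMapOfLift (footMap σ (pullback v₀) (Real.tanh t)) (torusProj x) ∧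
      v t (Θ t (torusProj x)) =
        descend (graphHeight σ (pullback v₀) t) (Θ t (torusProj x)) := fun x => by
    obtain ⟨θ, hθp, hθd, -⟩ := hF.exists_curve x
    obtain ⟨h1, h2⟩ := characteristic_eq (V := fun t => pullback (v t)) hF.smooth_graph
      (by rw [hF.init_graph]; exact h) (fun t ht y => hF.hasDerivAt_graph h.posDef ht y) hθd ht
    simp only [hF.init_graph] at h1 h2
    -- The lifted curve may start at an integer translate of `x`, so the comparison is made on the
    -- torus.
    have hx : torusProj (θ 0) = torusProj x := by rw [hθp 0 h0, hF.init_diffeo]; rfl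
    have h3 : Θ t (torusProj x) =
        torusProj (footMap σ (pullback v₀) (Real.tanh t) (θ 0)) := by rw [← hθp t ht, h2]
    refine ⟨by rw [h3, ← hx, hL], ?_⟩
    rw [h3, descend_torusProj (h.isPeriodic_graphHeight ht.1), h.graphHeight_footMap ht.1, ← h1, h2]
    rfl
  obtain ⟨-, Ψ, -, -, hΨ⟩ := hF.diffeo t ht
  constructor
  · funext ϑ
    obtain ⟨ϑ', rfl⟩ := hΨ.surjective ϑ
    obtain ⟨x, rfl⟩ := torusProj_surjective ϑ'
    exact (key x).2
  · funext ϑ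
    obtain ⟨x, rfl⟩ := torusProj_surjective ϑ
    exact (key x).1

end KottlerFlow

end

theorem proposition2p1 (σ : Matrix (Fin 2) (Fin 2) ℝ) (hσ : σ.PosDef)
    (v₀ : KottlerFlow.Torus → ℝ) (hv₀ : KottlerFlow.SmoothFun v₀)
    (hh : ∀ x, (KottlerFlow.graphSecondFF σ (KottlerFlow.pullback v₀) x).PosSemidef) :
    ∃ (v : ℝ → KottlerFlow.Torus → ℝ) (Θ : ℝ → KottlerFlow.Torus → KottlerFlow.Torus),
      KottlerFlow.IsUnitNormalFlow σ v₀ (Set.Ici 0) v Θ ∧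
      (∀ T : ℝ, 0 < T → ∀ (v' : ℝ → KottlerFlow.Torus → ℝ)
        (Θ' : ℝ → KottlerFlow.Torus → KottlerFlow.Torus),
        KottlerFlow.IsUnitNormalFlow σ v₀ (Set.Ico 0 T) v' Θ' →
          ∀ t ∈ Set.Ico 0 T, v' t = v t ∧ Θ' t = Θ t) ∧
      (∃ f : KottlerFlow.Torus → ℝ, KottlerFlow.SmoothFun f ∧
        ∀ ℓ : ℕ, KottlerFlow.ConvergesInC ℓ (fun t θ => v t θ - t) f) ∧
      ∃ Θinf : KottlerFlow.Torus → KottlerFlow.Torus,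
        KottlerFlow.IsTorusDiffeo Θinf ∧ KottlerFlow.ConvergesSmoothly Θ Θinf := by
  have h : KottlerFlow.IsConvexGraph σ (KottlerFlow.pullback v₀) :=
    ⟨hσ, hv₀, KottlerFlow.isPeriodic_pullback v₀, hh⟩
  exact ⟨_, _, h.isUnitNormalFlow, fun T _ v' Θ' hF t ht => hF.eq_of_convex h ht,
    ⟨_, h.smoothFun_renormHeight, h.convergesInC⟩,
    _, h.isTorusDiffeo_footMap zero_le_one, h.convergesSmoothly⟩
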